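/- Let $\Gamma$ be a group or a monoid. A ($2$-dimensional) representation of $\Gamma$ on a scheme $X$ is a monoid homomorphism $\rho:\Gamma\to \mathrm{M}_2(\Gamma(X,\mathcal{O}_X))$. For a $2\times 2$ matrix $A$ put $m(A)=\operatorname{tr}(A)^2-4\det(A)$. The representation $\rho$ has semi-simple mold if the $\mathcal{O}_X$-subalgebra $\mathcal{A}=\mathcal{O}_X[\rho(\Gamma)]$ of $\mathrm{M}_2(\mathcal{O}_X)$ is locally free of rank $2$ with locally free quotient $\mathrm{M}_2(\mathcal{O}_X)/\mathcal{A}$, and for each $x\in X$ there is $P\in\mathcal{A}_x$ with $m(P)\neq 0$ in the residue field $k(x)$. Let $A_2(\Gamma)$ be the coordinate ring of the affine scheme representing $X\mapsto\{2\text{-dimensional representations of }\Gamma\text{ on }X\}$, with universal representation $\sigma_\Gamma$. Let $A_2(\Gamma)_{\mathrm{rk}\le 2}$ be its quotient by all $3\times 3$ minors of the $4\times 3$ matrices whose columns are the entries of $\sigma_\Gamma(\alpha),\sigma_\Gamma(\beta),\sigma_\Gamma(\gamma)$, for $\alpha,\beta,\gamma\in\Gamma$, and let $A_2(\Gamma)^{\mathrm{Ch}}_{\mathrm{rk}\le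 2}\subseteq A_2(\Gamma)_{\mathrm{rk}\le 2}$ be the subring generated by $\operatorname{tr}\sigma_\Gamma(\gamma)$ and $\det\sigma_\Gamma(\gamma)$, $\gamma\in\Gamma$. Let $\mathrm{Rep}_2(\Gamma)_{\mathrm{s.s.}}\subseteq\operatorname{Spec}A_2(\Gamma)_{\mathrm{rk}\le 2}$ and $\mathrm{Ch}_2(\Gamma)_{\mathrm{s.s.}}\subseteq\operatorname{Spec}A_2(\Gamma)^{\mathrm{Ch}}_{\mathrm{rk}\le 2}$ be the open subschemes on which $m(\sigma_\Gamma(\gamma))\ne 0$ for some $\gamma\in\Gamma$; the scheme $\mathrm{Rep}_2(\Gamma)_{\mathrm{s.s.}}$ represents the functor $X\mapsto\{\text{representations of }\Gamma\text{ on }X\text{ with semi-simple mold}\}$. The inclusion of rings induces the canonical morphism $$\pi_{\Gamma,\mathrm{s.s.}}:\mathrm{Rep}_2(\Gamma)_{\mathrm{s.s.}}\to\mathrm{Ch}_2(\Gamma)_{\mathrm{s.s.}}.$$ The group scheme $\mathrm{PGL}_2$ over $\mathbb{Z}$, which represents $X\mapsto\operatorname{Aut}_{\mathcal{O}_X\text{-alg}}(\mathrm{M}_2(\mathcal{O}_X))$,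 acts on $\mathrm{Rep}_2(\Gamma)_{\mathrm{s.s.}}$ by $(\varphi,\rho)\mapsto\varphi\circ\rho$ (conjugation of representations). A morphism $\phi:X\to Y$ from a scheme $X$ with an action $\sigma:G\times X\to X$ of a group scheme $G$ is a geometric quotient by $G$ if (i) $\phi\circ\sigma=\phi\circ p_2$; (ii) $\phi$ is surjective and the image of $(\sigma,p_2):G\times X\to X\times X$ is that of $X\times_Y X$; (iii) a subset $U\subseteq Y$ is open if and only if $\phi^{-1}(U)$ is open; (iv) $\mathcal{O}_Y\to\phi_*\mathcal{O}_X$ is injective and its image is the subsheaf of invariant functions. It is a universal geometric quotient if for every morphism $Y'\to Y$ the projection $X\times_Y Y'\to Y'$ is a geometric quotient by $G$ for the induced action. **Corollary.** For every group or monoid $\Gamma$, the morphism $\pi_{\Gamma,\mathrm{s.s.}}:\mathrm{Rep}_2(\Gamma)_{\mathrm{s.s.}}\to\mathrm{Ch}_2(\Gamma)_{\mathrm{s.s.}}$ is a universal geometric quotient by $\mathrm{PGL}_2$. -/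

import Mathlib

open CategoryTheory Limits AlgebraicGeometry Opposite MonoidalCategory CartesianMonoidalCategory

universe u

namespace TwoDimRep

noncomputable section

/-- `2 × 2` matrices. -/
abbrev Mat (R : Type*) := Matrix (Fin 2) (Fin 2) R

section Algebra

variable {R S : Type*} [CommRing R] [CommRing S]

/-- `m(A) = tr(A)² - 4 det(A)`. -/
def disc (A : Mat R) : R := A.trace ^ 2 - 4 * A.det

theorem disc_map (f : R →+* S) (A : Mat R) : disc (f.mapMatrix A) = f (disc A) := by
  simp [disc, Matrix.trace_fin_two, Matrix.det_fin_two, map_ofNat f 4]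

/-- The `4 × 3` matrix whose columns are the entries of three `2 × 2` matrices. -/
def tripleMatrix (A : Fin 3 → Mat R) : Matrix (Fin 2 × Fin 2) (Fin 3) R :=
  Matrix.of fun p j => A j p.1 p.2

/-- The `3 × 3` determinant formed by the rows `r 0, r 1, r 2` of `tripleMatrix A`. -/
def tripleMinor (A : Fin 3 → Mat R) (r : Fin 3 → Fin 2 × Fin 2) : R :=
  ((tripleMatrix A).submatrix r id).det

theorem tripleMinor_map (f : R →+* S) (A : Fin 3 → Mat R) (r : Fin 3 → Fin 2 × Fin 2) :
    tripleMinor (fun j => f.mapMatrix (A j)) r = f (tripleMinor A r) := by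
  rw [tripleMinor, tripleMinor, RingHom.map_det]
  rfl

variable {Γ : Type*} [Monoid Γ]

/-- All `3 × 3` minors of the matrices `M(α, β, γ)` of `ρ` vanish. -/
def RankLETwo (ρ : Γ →* Mat R) : Prop :=
  ∀ (α β γ : Γ) (r : Fin 3 → Fin 2 × Fin 2), tripleMinor ![ρ α, ρ β, ρ γ] r = 0

/-- Base change of a representation along a ring homomorphism. -/
def mapRep (f : R →+* S) (ρ : Γ →* Mat R) : Γ →* Mat S :=
  (f.mapMatrix : Mat R →+* Mat S).toMonoidHom.comp ρ

@[simp] theorem mapRep_apply (f : R →+* S) (ρ : Γ →* Mat R) (γ : Γ) :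
    mapRep f ρ γ = f.mapMatrix (ρ γ) := rfl

theorem tripleMinor_mapRep (f : R →+* S) (ρ : Γ →* Mat R) (α β γ : Γ)
    (r : Fin 3 → Fin 2 × Fin 2) :
    tripleMinor ![mapRep f ρ α, mapRep f ρ β, mapRep f ρ γ] r =
      f (tripleMinor ![ρ α, ρ β, ρ γ] r) := by
  rw [← tripleMinor_map]
  congr 1
  ext j : 1
  fin_cases j <;> rfl

end Algebra

section CoordinateRings

variable (Γ : Type u) [Monoid Γ]

/-- The generic matrix attached to `γ`. -/
def genericMatrix (γ : Γ) : Mat (MvPolynomial (Γ × Fin 2 × Fin 2) ℤ) :=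
  Matrix.of fun i j => MvPolynomial.X (γ, i, j)

/-- The relations expressing that `γ ↦ genericMatrix γ` is a monoid homomorphism. -/
def repIdeal : Ideal (MvPolynomial (Γ × Fin 2 × Fin 2) ℤ) :=
  Ideal.span
    ({x | ∃ i j, x = (genericMatrix Γ 1 - 1) i j} ∪
      {x | ∃ γ δ i j, x = (genericMatrix Γ (γ * δ) - genericMatrix Γ γ * genericMatrix Γ δ) i j})

/-- The coordinate ring `A₂(Γ)` of the representation variety of degree 2. -/
def A₂ : Type u := MvPolynomial (Γ × Fin 2 × Fin 2) ℤ ⧸ repIdeal Γ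

instance : CommRing (A₂ Γ) := Ideal.Quotient.commRing (repIdeal Γ)

/-- The quotient map onto `A₂(Γ)`. -/
def toA₂ : MvPolynomial (Γ × Fin 2 × Fin 2) ℤ →+* A₂ Γ := Ideal.Quotient.mk (repIdeal Γ)

theorem toA₂_eq_zero {x : MvPolynomial (Γ × Fin 2 × Fin 2) ℤ} (hx : x ∈ repIdeal Γ) :
    toA₂ Γ x = 0 := Ideal.Quotient.eq_zero_iff_mem.2 hx

/-- The universal representation `σ_Γ : Γ → M₂(A₂(Γ))`. -/
def univRep : Γ →* Mat (A₂ Γ) where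
  toFun γ := (toA₂ Γ).mapMatrix (genericMatrix Γ γ)
  map_one' := by
    rw [← sub_eq_zero, ← map_one (toA₂ Γ).mapMatrix, ← map_sub]
    ext i j
    exact toA₂_eq_zero Γ (Ideal.subset_span (Or.inl ⟨i, j, rfl⟩))
  map_mul' γ δ := by
    rw [← sub_eq_zero, ← map_mul (toA₂ Γ).mapMatrix, ← map_sub]
    ext i j
    exact toA₂_eq_zero Γ (Ideal.subset_span (Or.inr ⟨γ, δ, i, j, rfl⟩))

/-- The ideal of all `3 × 3` minors of the matrices `M(α, β, γ)`. -/
def minorIdeal : Ideal (A₂ Γ) :=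
  Ideal.span {x | ∃ α β γ r, x = tripleMinor ![univRep Γ α, univRep Γ β, univRep Γ γ] r}

/-- The coordinate ring `A₂(Γ)_{rk ≤ 2}`. -/
def A₂rk : Type u := A₂ Γ ⧸ minorIdeal Γ

instance : CommRing (A₂rk Γ) := Ideal.Quotient.commRing (minorIdeal Γ)

/-- The quotient map `A₂(Γ) → A₂(Γ)_{rk ≤ 2}`. -/
def toA₂rk : A₂ Γ →+* A₂rk Γ := Ideal.Quotient.mk (minorIdeal Γ)

/-- The universal representation over `A₂(Γ)_{rk ≤ 2}`. -/
def univRepRk : Γ →* Mat (A₂rk Γ) := mapRep (toA₂rk Γ) (univRep Γ)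

/-- The subring of `A₂(Γ)_{rk ≤ 2}` generated by the traces and determinants of the universal
representation. -/
def A₂Ch : Subring (A₂rk Γ) :=
  Subring.closure
    (Set.range (fun γ => (univRepRk Γ γ).trace) ∪ Set.range (fun γ => (univRepRk Γ γ).det))

/-- `m(σ_Γ(γ))` as an element of the ring of traces and determinants. -/
def chDisc (γ : Γ) : A₂Ch Γ :=
  ⟨disc (univRepRk Γ γ), by
    have h1 : (univRepRk Γ γ).trace ∈ A₂Ch Γ := Subring.subset_closure (Or.inl ⟨γ, rfl⟩)
    have h2 : (univRepRk Γ γ).det ∈ A₂Ch Γ := Subring.subset_closure (Or.inr ⟨γ, rfl⟩)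
    exact sub_mem (pow_mem h1 2) (mul_mem (ofNat_mem _ 4) h2)⟩

variable {Γ} {R : Type*} [CommRing R]

theorem rankLETwo_univRepRk : RankLETwo (univRepRk Γ) := fun α β γ r => by
  rw [univRepRk, tripleMinor_mapRep]
  exact Ideal.Quotient.eq_zero_iff_mem.2 (Ideal.subset_span ⟨α, β, γ, r, rfl⟩)

/-- Evaluation of the generic matrices at a representation. -/
def evalRep (ρ : Γ →* Mat R) : MvPolynomial (Γ × Fin 2 × Fin 2) ℤ →+* R :=
  MvPolynomial.eval₂Hom (Int.castRingHom R) fun p => ρ p.1 p.2.1 p.2.2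

theorem evalRep_genericMatrix (ρ : Γ →* Mat R) (γ : Γ) :
    (evalRep ρ).mapMatrix (genericMatrix Γ γ) = ρ γ := by
  ext i j
  simp [genericMatrix, evalRep]

theorem evalRep_eq_zero (ρ : Γ →* Mat R) :
    ∀ a ∈ repIdeal Γ, evalRep ρ a = 0 := by
  suffices repIdeal Γ ≤ RingHom.ker (evalRep ρ) from fun a ha => this ha
  refine Ideal.span_le.2 ?_
  rintro x (⟨i, j, rfl⟩ | ⟨γ, δ, i, j, rfl⟩)
  · have : (evalRep ρ).mapMatrix (genericMatrix Γ 1 - 1) = 0 := by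
      rw [map_sub, evalRep_genericMatrix, map_one, map_one, sub_self]
    exact congrFun (congrFun this i) j
  · have : (evalRep ρ).mapMatrix
        (genericMatrix Γ (γ * δ) - genericMatrix Γ γ * genericMatrix Γ δ) = 0 := by
      simp only [map_sub, map_mul, evalRep_genericMatrix, sub_self]
    exact congrFun (congrFun this i) j

/-- The ring homomorphism `A₂(Γ) → R` classifying a representation over `R`. -/
def classify (ρ : Γ →* Mat R) : A₂ Γ →+* R :=
  Ideal.Quotient.lift (repIdeal Γ) (evalRep ρ) (evalRep_eq_zero ρ)

theorem mapRep_classify (ρ : Γ →* Mat R) : mapRep (classify ρ) (univRep Γ) = ρ := by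
  ext γ : 1
  exact evalRep_genericMatrix ρ γ

theorem A₂_hom_ext {f g : A₂ Γ →+* R} (h : mapRep f (univRep Γ) = mapRep g (univRep Γ)) :
    f = g := by
  refine Ideal.Quotient.ringHom_ext (MvPolynomial.ringHom_ext
    (fun n => RingHom.congr_fun (RingHom.ext_int (((f : A₂ Γ →+* R).comp (toA₂ Γ)).comp MvPolynomial.C)
      (((g : A₂ Γ →+* R).comp (toA₂ Γ)).comp MvPolynomial.C)) n) ?_)
  rintro ⟨γ, i, j⟩
  exact congrFun (congrFun (DFunLike.congr_fun h γ) i) j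

/-- `A₂(Γ)_{rk ≤ 2}` classifies the representations all of whose `3 × 3` minors vanish. -/
def rkEquiv : (A₂rk Γ →+* R) ≃ {ρ : Γ →* Mat R // RankLETwo ρ} where
  toFun f := ⟨mapRep f (univRepRk Γ), fun α β γ r => by
    rw [tripleMinor_mapRep, rankLETwo_univRepRk, map_zero]⟩
  invFun ρ := Ideal.Quotient.lift (minorIdeal Γ) (classify ρ.1) <| by
    suffices minorIdeal Γ ≤ RingHom.ker (classify ρ.1) from fun a ha => this ha
    refine Ideal.span_le.2 ?_
    rintro x ⟨α, β, γ, r, rfl⟩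
    rw [SetLike.mem_coe, RingHom.mem_ker, ← tripleMinor_mapRep, mapRep_classify]
    exact ρ.2 α β γ r
  left_inv f := by
    refine Ideal.Quotient.ringHom_ext (A₂_hom_ext (f := RingHom.comp _ (toA₂rk Γ))
      (g := f.comp (toA₂rk Γ)) ?_)
    exact mapRep_classify (mapRep f (univRepRk Γ))
  right_inv ρ := by
    exact Subtype.ext (mapRep_classify ρ.1)

end CoordinateRings

section MatrixAutomorphisms

variable {R S T : Type*} [CommRing R] [CommRing S] [CommRing T]

/-- The relations satisfied by the images of the matrix units under an algebra endomorphism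
of `M₂(R)`. -/
structure IsUnitSystem (e : Fin 2 → Fin 2 → Mat R) : Prop where
  sum_diag : e 0 0 + e 1 1 = 1
  mul_eq : ∀ i j k l, e i j * e k l = if j = k then e i l else 0

/-- The algebra endomorphism of `M₂(R)` with prescribed images of the matrix units. -/
def ofUnits (e : Fin 2 → Fin 2 → Mat R) (he : IsUnitSystem e) : Mat R →ₐ[R] Mat R :=
  AlgHom.ofLinearMap
    { toFun := fun Y => ∑ i, ∑ j, Y i j • e i j
      map_add' := fun Y Z => by
        simp only [Matrix.add_apply, add_smul, Finset.sum_add_distrib]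
      map_smul' := fun c Y => by
        simp only [Matrix.smul_apply, smul_eq_mul, mul_smul, Finset.smul_sum, RingHom.id_apply] }
    (by simpa [Fin.sum_univ_two] using he.sum_diag)
    (fun Y Z => by
      simp only [LinearMap.coe_mk, AddHom.coe_mk, Fin.sum_univ_two, mul_add, add_mul,
        smul_mul_smul_comm, he.mul_eq, Matrix.mul_apply]
      simp only [zero_ne_one, one_ne_zero, if_true, if_false, smul_zero, add_zero, zero_add]
      module)

theorem ofUnits_apply (e : Fin 2 → Fin 2 → Mat R) (he : IsUnitSystem e) (Y : Mat R) :
    ofUnits e he Y = ∑ i, ∑ j, Y i j • e i j := rfl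

theorem ofUnits_single (e : Fin 2 → Fin 2 → Mat R) (he : IsUnitSystem e) (i j : Fin 2) :
    ofUnits e he (Matrix.single i j 1) = e i j := by
  rw [ofUnits_apply]
  fin_cases i <;> fin_cases j <;> simp [Fin.sum_univ_two, Matrix.single_apply]

theorem eq_sum_single (Y : Mat R) : Y = ∑ i, ∑ j, Y i j • Matrix.single i j (1 : R) := by
  conv_lhs => rw [Matrix.matrix_eq_sum_single Y]
  simp [Matrix.smul_single]

theorem algHom_apply_eq_sum (φ : Mat R →ₐ[R] Mat R) (Y : Mat R) :
    φ Y = ∑ i, ∑ j, Y i j • φ (Matrix.single i j 1) := by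
  conv_lhs => rw [eq_sum_single Y]
  simp only [map_sum, map_smul]

theorem algHom_ext_units {φ ψ : Mat R →ₐ[R] Mat R}
    (h : ∀ i j, φ (Matrix.single i j 1) = ψ (Matrix.single i j 1)) : φ = ψ := by
  ext Y : 1
  rw [algHom_apply_eq_sum φ, algHom_apply_eq_sum ψ]
  simp only [h]

theorem isUnitSystem_map (f : R →+* S) (φ : Mat R →ₐ[R] Mat R) :
    IsUnitSystem fun i j => f.mapMatrix (φ (Matrix.single i j 1)) where
  sum_diag := by
    rw [← map_add, ← map_add]
    have : (Matrix.single 0 0 1 + Matrix.single 1 1 1 : Mat R) = 1 := by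
      ext i j
      fin_cases i <;> fin_cases j <;> simp
    rw [this, map_one, map_one]
  mul_eq i j k l := by
    rw [← map_mul, ← map_mul]
    split_ifs with h
    · subst h
      rw [Matrix.single_mul_single_same, one_mul]
    · rw [Matrix.single_mul_single_of_ne _ _ _ _ h, map_zero, map_zero]

/-- Base change of an algebra endomorphism of `M₂(R)` along `f : R → S`. -/
def mapEnd (f : R →+* S) (φ : Mat R →ₐ[R] Mat R) : Mat S →ₐ[S] Mat S :=
  ofUnits _ (isUnitSystem_map f φ)

theorem mapEnd_mapMatrix (f : R →+* S) (φ : Mat R →ₐ[R] Mat R) (Y : Mat R) :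
    mapEnd f φ (f.mapMatrix Y) = f.mapMatrix (φ Y) := by
  rw [algHom_apply_eq_sum φ Y, mapEnd, ofUnits_apply]
  ext i j
  simp [Fin.sum_univ_two]

theorem mapMatrix_single (f : R →+* S) (i j : Fin 2) :
    f.mapMatrix (Matrix.single i j 1) = Matrix.single i j 1 := by
  ext k l
  simp [Matrix.single_apply, apply_ite f]

theorem mapEnd_single (f : R →+* S) (φ : Mat R →ₐ[R] Mat R) (i j : Fin 2) :
    mapEnd f φ (Matrix.single i j 1) = f.mapMatrix (φ (Matrix.single i j 1)) := by
  rw [← mapEnd_mapMatrix, mapMatrix_single]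

theorem mapEnd_comp (f : R →+* S) (φ ψ : Mat R →ₐ[R] Mat R) :
    mapEnd f (φ.comp ψ) = (mapEnd f φ).comp (mapEnd f ψ) :=
  algHom_ext_units fun i j => by
    rw [AlgHom.comp_apply, mapEnd_single, mapEnd_single, mapEnd_mapMatrix, AlgHom.comp_apply]

theorem mapEnd_id (f : R →+* S) : mapEnd f (AlgHom.id R (Mat R)) = AlgHom.id S (Mat S) :=
  algHom_ext_units fun i j => by
    rw [mapEnd_single, AlgHom.id_apply, AlgHom.id_apply, mapMatrix_single]

/-- Base change of algebra automorphisms of `M₂(R)` along `f : R → S`. -/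
def mapAut (f : R →+* S) : (Mat R ≃ₐ[R] Mat R) →* (Mat S ≃ₐ[S] Mat S) where
  toFun φ := AlgEquiv.ofAlgHom (mapEnd f φ.toAlgHom) (mapEnd f φ.symm.toAlgHom)
    (by rw [← mapEnd_comp, ← mapEnd_id f]; congr 1; ext x : 1; exact φ.apply_symm_apply x)
    (by rw [← mapEnd_comp, ← mapEnd_id f]; congr 1; ext x : 1; exact φ.symm_apply_apply x)
  map_one' := AlgEquiv.ext fun Y => DFunLike.congr_fun (mapEnd_id f) Y
  map_mul' φ ψ := AlgEquiv.ext fun Y =>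
    DFunLike.congr_fun (mapEnd_comp f φ.toAlgHom ψ.toAlgHom) Y

theorem mapAut_mapMatrix (f : R →+* S) (φ : Mat R ≃ₐ[R] Mat R) (Y : Mat R) :
    mapAut f φ (f.mapMatrix Y) = f.mapMatrix (φ Y) :=
  mapEnd_mapMatrix f φ.toAlgHom Y

theorem algEquiv_ext_units {φ ψ : Mat R ≃ₐ[R] Mat R}
    (h : ∀ i j, φ (Matrix.single i j 1) = ψ (Matrix.single i j 1)) : φ = ψ :=
  AlgEquiv.ext fun Y => DFunLike.congr_fun
    (algHom_ext_units (φ := φ.toAlgHom) (ψ := ψ.toAlgHom) h) Y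

theorem mapAut_single (f : R →+* S) (φ : Mat R ≃ₐ[R] Mat R) (i j : Fin 2) :
    mapAut f φ (Matrix.single i j 1) = f.mapMatrix (φ (Matrix.single i j 1)) :=
  mapEnd_single f φ.toAlgHom i j

theorem mapAut_id (φ : Mat R ≃ₐ[R] Mat R) : mapAut (RingHom.id R) φ = φ :=
  algEquiv_ext_units fun i j => by rw [mapAut_single]; rfl

theorem mapAut_mapAut (f : R →+* S) (g : S →+* T) (φ : Mat R ≃ₐ[R] Mat R) :
    mapAut (g.comp f) φ = mapAut g (mapAut f φ) :=
  algEquiv_ext_units fun i j => by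
    rw [mapAut_single, mapAut_single, mapAut_single]; rfl

/-- An algebra automorphism of `M₂(R)` preserves traces. -/
theorem trace_aut (φ : Mat R ≃ₐ[R] Mat R) (Y : Mat R) : (φ Y).trace = Y.trace := by
  have hd : ∀ i j k l, φ (Matrix.single i j 1) * φ (Matrix.single k l 1) =
      if j = k then φ (Matrix.single i l 1) else 0 :=
    (isUnitSystem_map (RingHom.id R) φ.toAlgHom).mul_eq
  have h1 : φ (Matrix.single 0 0 1) + φ (Matrix.single 1 1 1) = 1 :=
    (isUnitSystem_map (RingHom.id R) φ.toAlgHom).sum_diag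
  obtain ⟨e, he⟩ : ∃ e : Fin 2 → Fin 2 → Mat R, ∀ i j, e i j = φ (Matrix.single i j 1) :=
    ⟨_, fun _ _ => rfl⟩
  simp only [← he] at hd h1
  have t01 : (e 0 1).trace = 0 := by
    have a := hd 0 0 0 1; have b := hd 0 1 0 0
    simp only [if_true] at a
    rw [if_neg (by decide)] at b
    rw [← a, Matrix.trace_mul_comm, b, Matrix.trace_zero]
  have t10 : (e 1 0).trace = 0 := by
    have a := hd 1 1 1 0; have b := hd 1 0 1 1
    simp only [if_true] at a
    rw [if_neg (by decide)] at b
    rw [← a, Matrix.trace_mul_comm, b, Matrix.trace_zero]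
  have a01 : e 0 1 * e 1 0 = e 0 0 := by simpa using hd 0 1 1 0
  have a10 : e 1 0 * e 0 1 = e 1 1 := by simpa using hd 1 0 0 1
  have a00 : e 0 0 * e 0 0 = e 0 0 := by simpa using hd 0 0 0 0
  have z : e 0 0 * e 1 1 = 0 := by simpa using hd 0 0 1 1
  have t : (e 1 1).trace = (e 0 0).trace := by
    rw [← a10, ← a01, Matrix.trace_mul_comm]
  have d : (e 0 0).det = 0 := by
    have d1 : (e 1 1).det = (e 0 0).det := by
      rw [← a10, ← a01, Matrix.det_mul, Matrix.det_mul, mul_comm]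
    have d2 : (e 0 0).det * (e 0 0).det = 0 := by
      have := congrArg Matrix.det z
      rw [Matrix.det_mul, d1] at this
      simpa using this
    have d3 : (e 0 0).det * (e 0 0).det = (e 0 0).det := by
      rw [← Matrix.det_mul, a00]
    rw [← d3, d2]
  have c : e 0 0 = (e 0 0).trace • e 0 0 := by
    have hc : e 0 0 * e 0 0 = (e 0 0).trace • e 0 0 - (e 0 0).det • (1 : Mat R) := by
      ext i j
      fin_cases i <;> fin_cases j <;>
        simp [Matrix.mul_apply, Fin.sum_univ_two, Matrix.trace_fin_two, Matrix.det_fin_two] <;> ring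
    rw [d, zero_smul, sub_zero, a00] at hc
    exact hc
  have c1 : e 1 1 = (e 0 0).trace • e 1 1 := by
    have : e 1 0 * e 0 0 * e 0 1 = e 1 1 := by
      have := hd 1 0 0 0
      simp only [if_true] at this
      rw [this, a10]
    rw [← this]
    conv_lhs => rw [c]
    simp
  have t00 : (e 0 0).trace = 1 := by
    have h : (1 : Mat R) = (e 0 0).trace • (1 : Mat R) := by
      rw [← h1, smul_add, ← c, ← c1]
    simpa using (congrFun (congrFun h 0) 0).symm
  have := algHom_apply_eq_sum φ.toAlgHom Y
  change φ Y = ∑ i, ∑ j, Y i j • φ (Matrix.single i j 1) at this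
  rw [this]
  simp only [← he, Fin.sum_univ_two, Matrix.trace_add, Matrix.trace_smul, t01, t10, t, t00,
    Matrix.trace_fin_two]
  simp

/-- An algebra automorphism of `M₂(R)` preserves `m`. -/
theorem disc_aut (φ : Mat R ≃ₐ[R] Mat R) (Y : Mat R) : disc (φ Y) = disc Y := by
  have h : ∀ A : Mat R, disc A = 2 * (A * A).trace - A.trace ^ 2 := fun A => by
    simp only [disc, Matrix.trace_fin_two, Matrix.det_fin_two, Matrix.mul_apply, Fin.sum_univ_two]
    ring
  rw [h, h, ← map_mul, trace_aut, trace_aut]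

/-- Minors of a triple vanish after applying a linear map if they vanish before. -/
theorem tripleMinor_linear (L : Mat R →ₗ[R] Mat R) (A : Fin 3 → Mat R)
    (h : ∀ r, tripleMinor A r = 0) (r : Fin 3 → Fin 2 × Fin 2) :
    tripleMinor (fun j => L (A j)) r = 0 := by
  have key : (tripleMatrix fun j => L (A j)).submatrix r id =
      fun i => ∑ p : Fin 2 × Fin 2, L (Matrix.single p.1 p.2 1) (r i).1 (r i).2 •
        tripleMatrix A p := by
    ext i j
    have hL : L (A j) = ∑ p : Fin 2 × Fin 2, A j p.1 p.2 • L (Matrix.single p.1 p.2 1) := by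
      conv_lhs => rw [eq_sum_single (A j)]
      simp only [map_sum, map_smul, Fintype.sum_prod_type]
    simp only [tripleMatrix, Matrix.submatrix_apply, Matrix.of_apply, hL, Finset.sum_apply,
      Matrix.sum_apply, Matrix.smul_apply, Pi.smul_apply, smul_eq_mul, id]
    exact Finset.sum_congr rfl fun p _ => mul_comm _ _
  change Matrix.detRowAlternating ((tripleMatrix fun j => L (A j)).submatrix r id) = 0
  rw [key]
  change Matrix.detRowAlternating.toMultilinearMap _ = 0
  rw [MultilinearMap.map_sum]
  refine Finset.sum_eq_zero fun s _ => ?_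
  rw [MultilinearMap.map_smul_univ]
  refine smul_eq_zero_of_right _ ?_
  exact h s

end MatrixAutomorphisms

section ProjectiveLinearGroup

/-- Indeterminates for the entries of the images of the matrix units under an algebra automorphism
of `M₂` (first component `true`) and under its inverse (first component `false`). -/
abbrev AutIndex : Type u := ULift.{u} (Bool × (Fin 2 × Fin 2) × (Fin 2 × Fin 2))

/-- The generic image of the matrix unit `E i j`. -/
def genericUnit (b : Bool) (i j : Fin 2) : Mat (MvPolynomial AutIndex.{u} ℤ) :=
  Matrix.of fun k l => MvPolynomial.X ⟨b, (i, j), (k, l)⟩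

/-- The generic image of `E i j` under one of the two generic endomorphisms followed by the other. -/
def genericComp (b : Bool) (i j : Fin 2) : Mat (MvPolynomial AutIndex.{u} ℤ) :=
  ∑ k, ∑ l, genericUnit b i j k l • genericUnit (!b) k l

/-- The relations expressing that the two families of generic images of the matrix units define
mutually inverse algebra endomorphisms of `M₂`. -/
def autIdeal : Ideal (MvPolynomial AutIndex.{u} ℤ) :=
  Ideal.span
    ({x | ∃ b p q, x = (genericUnit b 0 0 + genericUnit b 1 1 - 1) p q} ∪
      {x | ∃ b i j k l p q, x = (genericUnit b i j * genericUnit b k l -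
        if j = k then genericUnit b i l else 0) p q} ∪
      {x | ∃ b i j p q, x = genericComp b i j p q - Matrix.single i j 1 p q})

/-- The coordinate ring of `PGL₂`, representing `R ↦ Aut_{R-alg}(M₂(R))`. -/
def PGL₂Ring : Type u := MvPolynomial AutIndex.{u} ℤ ⧸ autIdeal.{u}

instance : CommRing PGL₂Ring.{u} := Ideal.Quotient.commRing autIdeal

/-- The quotient map onto the coordinate ring of `PGL₂`. -/
def toPGL₂Ring : MvPolynomial AutIndex.{u} ℤ →+* PGL₂Ring.{u} := Ideal.Quotient.mk autIdeal

theorem toPGL₂Ring_mapMatrix_eq_zero {A : Mat (MvPolynomial AutIndex.{u} ℤ)}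
    (hA : ∀ p q, A p q ∈ autIdeal.{u}) : toPGL₂Ring.mapMatrix A = 0 := by
  ext p q
  exact Ideal.Quotient.eq_zero_iff_mem.2 (hA p q)

variable {R S : Type*} [CommRing R] [CommRing S]

/-- The image of the matrix unit `E i j` under the automorphism given by a point of `PGL₂`
(`b = true`), or under the inverse automorphism (`b = false`). -/
def pointUnit (β : PGL₂Ring.{u} →+* R) (b : Bool) (i j : Fin 2) : Mat R :=
  (β.comp toPGL₂Ring).mapMatrix (genericUnit b i j)

theorem point_mapMatrix_eq_zero (β : PGL₂Ring.{u} →+* R)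
    {A : Mat (MvPolynomial AutIndex.{u} ℤ)} (hA : ∀ p q, A p q ∈ autIdeal.{u}) :
    (β.comp toPGL₂Ring).mapMatrix A = 0 :=
  (congrArg β.mapMatrix (toPGL₂Ring_mapMatrix_eq_zero hA)).trans (map_zero _)

theorem isUnitSystem_pointUnit (β : PGL₂Ring.{u} →+* R) (b : Bool) :
    IsUnitSystem (pointUnit β b) where
  sum_diag := by
    have := point_mapMatrix_eq_zero β (A := genericUnit b 0 0 + genericUnit b 1 1 - 1)
      fun p q => Ideal.subset_span (Or.inl (Or.inl ⟨b, p, q, rfl⟩))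
    rwa [map_sub, map_add, map_one, sub_eq_zero] at this
  mul_eq i j k l := by
    have := point_mapMatrix_eq_zero β (A := genericUnit b i j * genericUnit b k l -
        if j = k then genericUnit b i l else 0)
      fun p q => Ideal.subset_span (Or.inl (Or.inr ⟨b, i, j, k, l, p, q, rfl⟩))
    rw [map_sub, map_mul, sub_eq_zero, apply_ite (β.comp toPGL₂Ring).mapMatrix, map_zero] at this
    exact this

theorem ofUnits_pointUnit_comp (β : PGL₂Ring.{u} →+* R) (b : Bool) :
    (ofUnits _ (isUnitSystem_pointUnit β (!b))).comp (ofUnits _ (isUnitSystem_pointUnit β b)) =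
      AlgHom.id R (Mat R) :=
  algHom_ext_units fun i j => by
    rw [AlgHom.comp_apply, ofUnits_single, ofUnits_apply, AlgHom.id_apply]
    have := point_mapMatrix_eq_zero β
      (A := genericComp b i j - Matrix.single i j 1)
      fun p q => Ideal.subset_span (Or.inr ⟨b, i, j, p, q, rfl⟩)
    rw [map_sub, sub_eq_zero, mapMatrix_single] at this
    rw [← this]
    simp only [genericComp, map_sum]
    refine Finset.sum_congr rfl fun k _ => Finset.sum_congr rfl fun l _ => ?_
    ext p q
    simp [pointUnit]

/-- The algebra automorphism of `M₂(R)` given by an `R`-valued point of `PGL₂`. -/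
def pointAut (β : PGL₂Ring.{u} →+* R) : Mat R ≃ₐ[R] Mat R :=
  AlgEquiv.ofAlgHom (ofUnits _ (isUnitSystem_pointUnit β true))
    (ofUnits _ (isUnitSystem_pointUnit β false))
    (ofUnits_pointUnit_comp β false) (ofUnits_pointUnit_comp β true)

theorem pointAut_single (β : PGL₂Ring.{u} →+* R) (i j : Fin 2) :
    pointAut β (Matrix.single i j 1) = pointUnit β true i j :=
  ofUnits_single _ (isUnitSystem_pointUnit β true) i j

theorem pointAut_symm_single (β : PGL₂Ring.{u} →+* R) (i j : Fin 2) :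
    (pointAut β).symm (Matrix.single i j 1) = pointUnit β false i j :=
  ofUnits_single _ (isUnitSystem_pointUnit β false) i j

/-- Evaluation of the generic images of the matrix units at an automorphism. -/
def evalAut (φ : Mat R ≃ₐ[R] Mat R) : MvPolynomial AutIndex.{u} ℤ →+* R :=
  MvPolynomial.eval₂Hom (Int.castRingHom R) fun s =>
    (bif s.down.1 then φ else φ.symm)
      (Matrix.single s.down.2.1.1 s.down.2.1.2 1) s.down.2.2.1 s.down.2.2.2

theorem evalAut_genericUnit (φ : Mat R ≃ₐ[R] Mat R) (b : Bool) (i j : Fin 2) :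
    (evalAut.{u} φ).mapMatrix (genericUnit b i j) =
      (bif b then φ else φ.symm) (Matrix.single i j 1) := by
  ext k l
  simp [genericUnit, evalAut]

theorem evalAut_eq_zero (φ : Mat R ≃ₐ[R] Mat R) :
    ∀ a ∈ autIdeal.{u}, evalAut φ a = 0 := by
  suffices autIdeal.{u} ≤ RingHom.ker (evalAut φ) from fun a ha => this ha
  have hu : ∀ b : Bool, IsUnitSystem
      fun i j => (bif b then φ else φ.symm) (Matrix.single i j 1) := fun b =>
    isUnitSystem_map (RingHom.id R) (bif b then φ else φ.symm).toAlgHom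
  refine Ideal.span_le.2 ?_
  rintro x ((⟨b, p, q, rfl⟩ | ⟨b, i, j, k, l, p, q, rfl⟩) | ⟨b, i, j, p, q, rfl⟩)
  · have : (evalAut φ).mapMatrix (genericUnit b 0 0 + genericUnit b 1 1 - 1) = 0 := by
      rw [map_sub, map_add, evalAut_genericUnit, evalAut_genericUnit, map_one, sub_eq_zero]
      exact (hu b).sum_diag
    exact congrFun (congrFun this p) q
  · have : (evalAut φ).mapMatrix (genericUnit b i j * genericUnit b k l -
        if j = k then genericUnit b i l else 0) = 0 := by
      rw [map_sub, map_mul, sub_eq_zero, apply_ite (evalAut φ).mapMatrix, map_zero]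
      simp only [evalAut_genericUnit]
      exact (hu b).mul_eq i j k l
    exact congrFun (congrFun this p) q
  · have : (evalAut φ).mapMatrix (genericComp b i j - Matrix.single i j 1) = 0 := by
      rw [map_sub, sub_eq_zero, mapMatrix_single]
      have h : (evalAut φ).mapMatrix (genericComp b i j) =
          (bif !b then φ else φ.symm) ((bif b then φ else φ.symm) (Matrix.single i j 1)) := by
        have e := algHom_apply_eq_sum (bif !b then φ else φ.symm).toAlgHom
          ((bif b then φ else φ.symm) (Matrix.single i j 1))
        refine Eq.trans ?_ e.symm
        rw [← evalAut_genericUnit]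
        simp only [genericComp, map_sum]
        refine Finset.sum_congr rfl fun k _ => Finset.sum_congr rfl fun l _ => ?_
        refine Eq.trans ?_ (congrArg _ (evalAut_genericUnit φ (!b) k l))
        ext p q
        simp
        rfl
      rw [h]
      cases b
      · exact φ.apply_symm_apply _
      · exact φ.symm_apply_apply _
    exact congrFun (congrFun this p) q

/-- The coordinate ring of `PGL₂` represents `R ↦ Aut_{R-alg}(M₂(R))`. -/
def pointAutEquiv : (PGL₂Ring.{u} →+* R) ≃ (Mat R ≃ₐ[R] Mat R) where
  toFun := pointAut
  invFun φ := Ideal.Quotient.lift autIdeal (evalAut φ) (evalAut_eq_zero φ)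
  left_inv β := by
    refine Ideal.Quotient.ringHom_ext (MvPolynomial.ringHom_ext
      (fun n => RingHom.congr_fun (RingHom.ext_int
        (RingHom.comp (RingHom.comp (Ideal.Quotient.lift autIdeal (evalAut (pointAut β))
          (evalAut_eq_zero (pointAut β)) : PGL₂Ring.{u} →+* R) toPGL₂Ring) MvPolynomial.C)
        ((β.comp toPGL₂Ring).comp MvPolynomial.C)) n) ?_)
    rintro ⟨b, ⟨i, j⟩, ⟨k, l⟩⟩
    have h := evalAut_genericUnit.{u} (pointAut β) b i j
    have h' : (bif b then pointAut β else (pointAut β).symm) (Matrix.single i j 1) =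
        pointUnit β b i j := by
      cases b
      · exact pointAut_symm_single β i j
      · exact pointAut_single β i j
    exact congrFun (congrFun (h.trans h') k) l
  right_inv φ := algEquiv_ext_units fun i j =>
    (pointAut_single _ i j).trans (evalAut_genericUnit φ true i j)

theorem pointAutEquiv_comp (f : R →+* S) (β : PGL₂Ring.{u} →+* R) :
    pointAutEquiv (f.comp β) = mapAut f (pointAutEquiv β) :=
  algEquiv_ext_units fun i j => by
    rw [mapAut_single]
    change pointAut (f.comp β) _ = f.mapMatrix (pointAut β _)
    rw [pointAut_single, pointAut_single]
    rfl

end ProjectiveLinearGroup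

section Points

/-- Morphisms to an affine scheme are ring homomorphisms on global sections. -/
def specPoints (T : Scheme.{u}) (A : Type u) [CommRing A] :
    (T ⟶ Spec (.of A)) ≃ (A →+* Γ(T, ⊤)) where
  toFun f := ((Scheme.ΓSpecIso (.of A)).inv ≫ f.appTop).hom
  invFun φ := T.toSpecΓ ≫ Spec.map (CommRingCat.ofHom φ)
  left_inv f := by
    change T.toSpecΓ ≫ Spec.map ((Scheme.ΓSpecIso (.of A)).inv ≫ f.appTop) = f
    rw [Spec.map_comp, ← Scheme.toSpecΓ_naturality_assoc, toSpecΓ_SpecMap_ΓSpecIso_inv,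
      Category.comp_id]
  right_inv φ := by
    change ((Scheme.ΓSpecIso (.of A)).inv ≫ (T.toSpecΓ ≫ Spec.map (CommRingCat.ofHom φ)).appTop).hom
      = φ
    rw [Scheme.Hom.comp_appTop, Scheme.toSpecΓ_appTop, ← Scheme.ΓSpecIso_inv_naturality_assoc,
      Iso.inv_hom_id, Category.comp_id]
    rfl

theorem specPoints_comp {T T' : Scheme.{u}} {A : Type u} [CommRing A] (g : T' ⟶ T)
    (f : T ⟶ Spec (.of A)) :
    specPoints T' A (g ≫ f) = g.appTop.hom.comp (specPoints T A f) := by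
  simp [specPoints]
  rfl

theorem specPoints_preimage_basicOpen {T : Scheme.{u}} {A : Type u} [CommRing A]
    (f : T ⟶ Spec (.of A)) (a : A) :
    f ⁻¹ᵁ (PrimeSpectrum.basicOpen a : (Spec (.of A)).Opens) =
      T.basicOpen (specPoints T A f a) := by
  have h := Scheme.preimage_basicOpen f ((Scheme.ΓSpecIso (.of A)).inv a)
  rw [basicOpen_eq_of_affine] at h
  exact h

end Points

section Molds

variable {Γ : Type*} [Monoid Γ] {R : Type*} [CommRing R]

/-- The `R`-subalgebra `R[ρ(Γ)]` of `M₂(R)` generated by the image of `ρ`. -/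
def repAlgebra (ρ : Γ →* Mat R) : Subalgebra R (Mat R) := Algebra.adjoin R (Set.range ρ)

theorem repAlgebra_toSubmodule (ρ : Γ →* Mat R) :
    Subalgebra.toSubmodule (repAlgebra ρ) = Submodule.span R (Set.range ρ) := by
  have h : ((MonoidHom.mrange ρ : Submonoid (Mat R)) : Set (Mat R)) = Set.range ρ := rfl
  rw [repAlgebra, Algebra.adjoin_eq_span, ← h, Submonoid.closure_eq]

/-- A representation generating a free rank two algebra has vanishing `3 × 3` minors. -/
theorem rankLETwo_of_finrank [Nontrivial R] (ρ : Γ →* Mat R)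
    (hfree : Module.Free R (repAlgebra ρ)) (hrank : Module.finrank R (repAlgebra ρ) = 2) :
    RankLETwo ρ := by
  have hfin : Module.Finite R (repAlgebra ρ) := Module.finite_of_finrank_eq_succ hrank
  let b := Module.finBasisOfFinrankEq R (repAlgebra ρ) hrank
  have key : ∀ γ, ∃ s t : R, ρ γ = s • (b 0 : Mat R) + t • (b 1 : Mat R) := fun γ => by
    refine ⟨b.repr ⟨ρ γ, Algebra.subset_adjoin ⟨γ, rfl⟩⟩ 0,
      b.repr ⟨ρ γ, Algebra.subset_adjoin ⟨γ, rfl⟩⟩ 1, ?_⟩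
    have := congrArg Subtype.val (b.sum_repr ⟨ρ γ, Algebra.subset_adjoin ⟨γ, rfl⟩⟩)
    rw [Fin.sum_univ_two] at this
    exact this.symm
  intro α β γ r
  obtain ⟨a0, a1, ha⟩ := key α
  obtain ⟨b0, b1, hb⟩ := key β
  obtain ⟨c0, c1, hc⟩ := key γ
  rw [ha, hb, hc, tripleMinor, Matrix.det_fin_three]
  simp [tripleMatrix]
  ring

/-- The classes of `A` and `B` modulo scalar matrices are proportional. -/
structure Parallel (A B : Mat R) : Prop where
  h12 : A 0 1 * B 1 0 = A 1 0 * B 0 1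
  h01 : (A 0 0 - A 1 1) * B 0 1 = A 0 1 * (B 0 0 - B 1 1)
  h02 : (A 0 0 - A 1 1) * B 1 0 = A 1 0 * (B 0 0 - B 1 1)

theorem RankLETwo.parallel {ρ : Γ →* Mat R} (h : RankLETwo ρ) (α β : Γ) :
    Parallel (ρ α) (ρ β) := by
  have e1 := h 1 α β ![(0, 0), (0, 1), (1, 0)]
  have e2 := h 1 α β ![(0, 0), (0, 1), (1, 1)]
  have e3 := h 1 α β ![(0, 0), (1, 0), (1, 1)]
  rw [tripleMinor, Matrix.det_fin_three] at e1 e2 e3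
  simp [tripleMatrix] at e1 e2 e3
  exact ⟨by linear_combination e1, by linear_combination e2, by linear_combination e3⟩

theorem parallel_of_mem {ρ : Γ →* Mat R} (h : RankLETwo ρ) {P : Mat R} (hP : P ∈ repAlgebra ρ)
    (β : Γ) : Parallel P (ρ β) := by
  have hP' : P ∈ Submodule.span R (Set.range ρ) := by
    rw [← repAlgebra_toSubmodule]; exact hP
  induction hP' using Submodule.span_induction with
  | mem x hx => obtain ⟨α, rfl⟩ := hx; exact h.parallel α β
  | zero => exact ⟨by simp, by simp, by simp⟩
  | add x y _ _ hx hy =>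
    have hx := hx (by rw [← Subalgebra.mem_toSubmodule, repAlgebra_toSubmodule]; assumption)
    have hy := hy (by rw [← Subalgebra.mem_toSubmodule, repAlgebra_toSubmodule]; assumption)
    refine ⟨?_, ?_, ?_⟩ <;> simp only [Matrix.add_apply]
    · linear_combination hx.h12 + hy.h12
    · linear_combination hx.h01 + hy.h01
    · linear_combination hx.h02 + hy.h02
  | smul a x _ hx =>
    have hx := hx (by rw [← Subalgebra.mem_toSubmodule, repAlgebra_toSubmodule]; assumption)
    refine ⟨?_, ?_, ?_⟩ <;> simp only [Matrix.smul_apply, smul_eq_mul]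
    · linear_combination a * hx.h12
    · linear_combination a * hx.h01
    · linear_combination a * hx.h02

theorem disc_eq (A : Mat R) : disc A = (A 0 0 - A 1 1) ^ 2 + 4 * (A 0 1 * A 1 0) := by
  simp only [disc, Matrix.trace_fin_two, Matrix.det_fin_two]
  ring

/-- If some element of `R[ρ(Γ)]` has nonzero discriminant in a field, so has some `ρ γ`. -/
theorem exists_disc_ne_zero {K : Type*} [Field K] (f : R →+* K) {ρ : Γ →* Mat R}
    (h : RankLETwo ρ) {P : Mat R} (hP : P ∈ repAlgebra ρ) (hd : f (disc P) ≠ 0) :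
    ∃ γ, f (disc (ρ γ)) ≠ 0 := by
  by_contra! hc
  rw [disc_eq] at hd
  have hz : ∀ γ, f (ρ γ 0 1) = 0 ∧ f (ρ γ 1 0) = 0 ∧ f (ρ γ 0 0 - ρ γ 1 1) = 0 := fun γ => by
    have hp := parallel_of_mem h hP γ
    have h12 := congrArg f hp.h12
    have h01 := congrArg f hp.h01
    have h02 := congrArg f hp.h02
    have hq := hc γ
    rw [disc_eq] at hq
    simp only [map_add, map_mul, map_pow, map_sub, map_ofNat] at h12 h01 h02 hq hd ⊢
    generalize f (P 0 0) - f (P 1 1) = p0 at *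
    generalize f (P 0 1) = p1 at *
    generalize f (P 1 0) = p2 at *
    generalize f (ρ γ 0 0) - f (ρ γ 1 1) = q0 at *
    generalize f (ρ γ 0 1) = q1 at *
    generalize f (ρ γ 1 0) = q2 at *
    have s0 : (p0 ^ 2 + 4 * (p1 * p2)) * q0 ^ 2 = 0 := by
      linear_combination p0 ^ 2 * hq - 4 * p0 * q2 * h01 - 4 * p1 * q0 * h02
    have s1 : (p0 ^ 2 + 4 * (p1 * p2)) * q1 ^ 2 = 0 := by
      linear_combination p1 ^ 2 * hq + (p0 * q1 + p1 * q0) * h01 - 4 * p1 * q1 * h12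
    have s2 : (p0 ^ 2 + 4 * (p1 * p2)) * q2 ^ 2 = 0 := by
      linear_combination p2 ^ 2 * hq + (p0 * q2 + p2 * q0) * h02 + 4 * p2 * q2 * h12
    refine ⟨?_, ?_, ?_⟩
    · exact pow_eq_zero_iff two_ne_zero |>.1 ((mul_eq_zero.1 s1).resolve_left hd)
    · exact pow_eq_zero_iff two_ne_zero |>.1 ((mul_eq_zero.1 s2).resolve_left hd)
    · exact pow_eq_zero_iff two_ne_zero |>.1 ((mul_eq_zero.1 s0).resolve_left hd)
  have hP' : P ∈ Submodule.span R (Set.range ρ) := by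
    rw [← repAlgebra_toSubmodule]; exact hP
  have hPz : f (P 0 1) = 0 ∧ f (P 1 0) = 0 ∧ f (P 0 0 - P 1 1) = 0 := by
    clear hd hP
    induction hP' using Submodule.span_induction with
    | mem x hx => obtain ⟨α, rfl⟩ := hx; exact hz α
    | zero => simp
    | add x y _ _ hx hy =>
      obtain ⟨x1, x2, x3⟩ := hx
      obtain ⟨y1, y2, y3⟩ := hy
      simp only [map_sub] at x3 y3
      simp only [Matrix.add_apply, map_add, map_sub]
      exact ⟨by rw [x1, y1, add_zero], by rw [x2, y2, add_zero], by linear_combination x3 + y3⟩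
    | smul a x _ hx =>
      obtain ⟨x1, x2, x3⟩ := hx
      simp only [map_sub] at x3
      simp only [Matrix.smul_apply, smul_eq_mul, map_mul, map_sub]
      exact ⟨by rw [x1, mul_zero], by rw [x2, mul_zero], by linear_combination f a * x3⟩
  apply hd
  rw [map_add, map_pow, map_mul, map_mul, hPz.1, hPz.2.2]
  ring

theorem repAlgebra_free_aux (ρ : Γ →* Mat R) (γ : Γ) [Nontrivial R] (q : Mat R →ₗ[R] (Fin 2 → R))
    (hq : Function.Surjective q) (hρ : ∀ δ, q (ρ δ) = 0)
    (hker : ∀ Y, q Y = 0 → ∃ s t : R, Y = s • (1 : Mat R) + t • ρ γ)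
    (hinj : ∀ s t : R, s • (1 : Mat R) + t • ρ γ = 0 → s = 0 ∧ t = 0) :
    Module.Free R (Mat R ⧸ Subalgebra.toSubmodule (repAlgebra ρ)) ∧
      Module.Free R (repAlgebra ρ) ∧ Module.finrank R (repAlgebra ρ) = 2 := by
  have h1 : (1 : Mat R) ∈ repAlgebra ρ := one_mem _
  have hγ : ρ γ ∈ repAlgebra ρ := Algebra.subset_adjoin ⟨γ, rfl⟩
  have hN : LinearMap.ker q = Subalgebra.toSubmodule (repAlgebra ρ) := by
    apply le_antisymm
    · intro Y hY
      obtain ⟨s, t, rfl⟩ := hker Y hY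
      exact add_mem (Subalgebra.smul_mem _ h1 s) (Subalgebra.smul_mem _ hγ t)
    · rw [repAlgebra_toSubmodule, Submodule.span_le]
      rintro _ ⟨δ, rfl⟩
      exact hρ δ
  let L : (Fin 2 → R) →ₗ[R] repAlgebra ρ :=
    Fintype.linearCombination R ![(⟨1, h1⟩ : repAlgebra ρ), ⟨ρ γ, hγ⟩]
  have hL : ∀ v, (L v : Mat R) = v 0 • (1 : Mat R) + v 1 • ρ γ := fun v => by
    simp [L, Fintype.linearCombination_apply, Fin.sum_univ_two]
  have hLb : Function.Bijective L := by
    constructor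
    · refine (injective_iff_map_eq_zero L).2 fun v hv => ?_
      have := hinj (v 0) (v 1) (by rw [← hL, hv]; rfl)
      ext i
      fin_cases i
      · exact this.1
      · exact this.2
    · rintro ⟨Y, hY⟩
      rw [← Subalgebra.mem_toSubmodule, ← hN] at hY
      obtain ⟨s, t, rfl⟩ := hker Y hY
      exact ⟨![s, t], Subtype.ext (by rw [hL]; rfl)⟩
  let e : (Fin 2 → R) ≃ₗ[R] repAlgebra ρ := LinearEquiv.ofBijective L hLb
  refine ⟨?_, Module.Free.of_equiv e, ?_⟩
  · rw [← hN]
    exact Module.Free.of_equiv (q.quotKerEquivOfSurjective hq).symm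
  · rw [← e.finrank_eq]
    simp

/-- If the `3 × 3` minors vanish and `ρ γ` is nowhere scalar in a uniform way, then `R[ρ(Γ)]` is
free of rank two with free quotient. -/
theorem repAlgebra_free [Nontrivial R] {ρ : Γ →* Mat R} (h : RankLETwo ρ) (γ : Γ)
    (hu : IsUnit (ρ γ 0 0 - ρ γ 1 1) ∨ IsUnit (ρ γ 0 1) ∨ IsUnit (ρ γ 1 0)) :
    Module.Free R (Mat R ⧸ Subalgebra.toSubmodule (repAlgebra ρ)) ∧
      Module.Free R (repAlgebra ρ) ∧ Module.finrank R (repAlgebra ρ) = 2 := by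
  rcases hu with hu | hu | hu
  · obtain ⟨v, hv⟩ := hu.exists_left_inv
    refine repAlgebra_free_aux ρ γ
      { toFun := fun Y => ![Y 0 1 - (Y 0 0 - Y 1 1) * v * ρ γ 0 1,
          Y 1 0 - (Y 0 0 - Y 1 1) * v * ρ γ 1 0]
        map_add' := fun Y Z => by ext i; fin_cases i <;> simp <;> ring
        map_smul' := fun c Y => by ext i; fin_cases i <;> simp <;> ring } ?_ ?_ ?_ ?_
    · intro w
      refine ⟨!![0, w 0; w 1, 0], ?_⟩
      ext i; fin_cases i <;> simp
    · intro δ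
      have hp := h.parallel γ δ
      ext i; fin_cases i
      · simp; linear_combination v * hp.h01 - ρ δ 0 1 * hv
      · simp; linear_combination v * hp.h02 - ρ δ 1 0 * hv
    · intro Y hY
      have y0 := congrFun hY 0
      have y1 := congrFun hY 1
      simp at y0 y1
      refine ⟨Y 1 1 - (Y 0 0 - Y 1 1) * v * ρ γ 1 1, (Y 0 0 - Y 1 1) * v, ?_⟩
      ext i j; fin_cases i <;> fin_cases j <;> simp
      · linear_combination -(Y 0 0 - Y 1 1) * hv
      · linear_combination y0
      · linear_combination y1
    · intro s t hst
      have e0 := congrFun (congrFun hst 0) 0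
      have e1 := congrFun (congrFun hst 1) 1
      simp at e0 e1
      have ht : t = 0 := by linear_combination v * (e0 - e1) - t * hv
      subst ht
      exact ⟨by simpa using e0, rfl⟩
  · obtain ⟨v, hv⟩ := hu.exists_left_inv
    refine repAlgebra_free_aux ρ γ
      { toFun := fun Y => ![(Y 0 0 - Y 1 1) - Y 0 1 * v * (ρ γ 0 0 - ρ γ 1 1),
          Y 1 0 - Y 0 1 * v * ρ γ 1 0]
        map_add' := fun Y Z => by ext i; fin_cases i <;> simp <;> ring
        map_smul' := fun c Y => by ext i; fin_cases i <;> simp <;> ring } ?_ ?_ ?_ ?_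
    · intro w
      refine ⟨!![w 0, 0; w 1, 0], ?_⟩
      ext i; fin_cases i <;> simp
    · intro δ
      have hp := h.parallel γ δ
      ext i; fin_cases i
      · simp; linear_combination -v * hp.h01 - (ρ δ 0 0 - ρ δ 1 1) * hv
      · simp; linear_combination v * hp.h12 - ρ δ 1 0 * hv
    · intro Y hY
      have y0 := congrFun hY 0
      have y1 := congrFun hY 1
      simp at y0 y1
      refine ⟨Y 1 1 - Y 0 1 * v * ρ γ 1 1, Y 0 1 * v, ?_⟩
      ext i j; fin_cases i <;> fin_cases j <;> simp
      · linear_combination y0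
      · linear_combination -Y 0 1 * hv
      · linear_combination y1
    · intro s t hst
      have e0 := congrFun (congrFun hst 0) 0
      have e1 := congrFun (congrFun hst 0) 1
      simp at e0 e1
      have ht : t = 0 := by linear_combination v * e1 - t * hv
      subst ht
      exact ⟨by simpa using e0, rfl⟩
  · obtain ⟨v, hv⟩ := hu.exists_left_inv
    refine repAlgebra_free_aux ρ γ
      { toFun := fun Y => ![(Y 0 0 - Y 1 1) - Y 1 0 * v * (ρ γ 0 0 - ρ γ 1 1),
          Y 0 1 - Y 1 0 * v * ρ γ 0 1]
        map_add' := fun Y Z => by ext i; fin_cases i <;> simp <;> ring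
        map_smul' := fun c Y => by ext i; fin_cases i <;> simp <;> ring } ?_ ?_ ?_ ?_
    · intro w
      refine ⟨!![w 0, w 1; 0, 0], ?_⟩
      ext i; fin_cases i <;> simp
    · intro δ
      have hp := h.parallel γ δ
      ext i; fin_cases i
      · simp; linear_combination -v * hp.h02 - (ρ δ 0 0 - ρ δ 1 1) * hv
      · simp; linear_combination -v * hp.h12 - ρ δ 0 1 * hv
    · intro Y hY
      have y0 := congrFun hY 0
      have y1 := congrFun hY 1
      simp at y0 y1
      refine ⟨Y 1 1 - Y 1 0 * v * ρ γ 1 1, Y 1 0 * v, ?_⟩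
      ext i j; fin_cases i <;> fin_cases j <;> simp
      · linear_combination y0
      · linear_combination y1
      · linear_combination -Y 1 0 * hv
    · intro s t hst
      have e0 := congrFun (congrFun hst 0) 0
      have e1 := congrFun (congrFun hst 1) 0
      simp at e0 e1
      have ht : t = 0 := by linear_combination v * e1 - t * hv
      subst ht
      exact ⟨by simpa using e0, rfl⟩

variable {T : Scheme.{u}}

/-- The restriction of a representation on `T` to an open subset. -/
def restrictRep (ρ : Γ →* Mat Γ(T, ⊤)) (U : T.Opens) : Γ →* Mat Γ(T, U) :=
  mapRep (T.presheaf.map (homOfLE le_top).op).hom ρ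

/-- A representation `ρ` of `Γ` on a scheme `T` has semi-simple mold: the `𝒪_T`-subalgebra
`𝒪_T[ρ(Γ)]` of `M₂(𝒪_T)` is a mold of rank 2, and around every point `x` it has a section `P` with
`m(P) ≠ 0` in the residue field at `x`. As `𝒪_T[ρ(Γ)]` is generated by global sections as an
`𝒪_T`-module, it is quasi-coherent, and over an affine open `U` its sections are the `Γ(T, U)`-algebra
`repAlgebra (restrictRep ρ U)`. -/
structure HasSemisimpleMold (ρ : Γ →* Mat Γ(T, ⊤)) : Prop where
  isMold_rank_two : ∀ x : T, ∃ U : T.Opens, IsAffineOpen U ∧ x ∈ U ∧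
    Module.Free Γ(T, U)
      (Mat Γ(T, U) ⧸ Subalgebra.toSubmodule (repAlgebra (restrictRep ρ U))) ∧
    Module.Free Γ(T, U) (repAlgebra (restrictRep ρ U)) ∧
    Module.finrank Γ(T, U) (repAlgebra (restrictRep ρ U)) = 2
  semisimple : ∀ x : T, ∃ U : T.Opens, IsAffineOpen U ∧ x ∈ U ∧
    ∃ P ∈ repAlgebra (restrictRep ρ U), x ∈ T.basicOpen (disc P)

theorem mem_basicOpen_map {U V : T.Opens} (i : op U ⟶ op V) (f : Γ(T, U)) {x : T} (hx : x ∈ V) :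
    x ∈ T.basicOpen ((T.presheaf.map i).hom f) ↔ x ∈ T.basicOpen f := by
  have := T.basicOpen_res f i
  change T.basicOpen ((T.presheaf.map i).hom f) = _ at this
  rw [this]
  exact ⟨fun h => h.2, fun h => ⟨hx, h⟩⟩

/-- The criterion for semi-simple molds in terms of minors and discriminants. -/
theorem hasSemisimpleMold_iff (ρ : Γ →* Mat Γ(T, ⊤)) :
    HasSemisimpleMold ρ ↔ RankLETwo ρ ∧ ∀ x : T, ∃ γ, x ∈ T.basicOpen (disc (ρ γ)) := by
  constructor
  · rintro ⟨h1, h2⟩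
    have hrk : RankLETwo ρ := by
      intro α β γ r
      refine TopCat.Presheaf.section_ext T.sheaf ⊤ _ _ fun x hx => ?_
      obtain ⟨U, hU, hxU, -, hfree, hrank⟩ := h1 x
      have : Nonempty U := ⟨⟨x, hxU⟩⟩
      have hz := rankLETwo_of_finrank (restrictRep ρ U) hfree hrank α β γ r
      rw [restrictRep, tripleMinor_mapRep] at hz
      have := T.presheaf.germ_res_apply (homOfLE (le_top : U ≤ ⊤)) x hxU
        (tripleMinor ![ρ α, ρ β, ρ γ] r)
      refine this.symm.trans ?_
      refine (congrArg (T.presheaf.germ U x hxU).hom hz).trans ?_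
      rw [map_zero]
      exact (map_zero (T.presheaf.germ ⊤ x hx).hom).symm
    refine ⟨hrk, fun x => ?_⟩
    obtain ⟨U, hU, hxU, P, hP, hd⟩ := h2 x
    have hrkU : RankLETwo (restrictRep ρ U) := fun α β γ r => by
      rw [restrictRep, tripleMinor_mapRep, hrk, map_zero]
    rw [← T.evaluation_ne_zero_iff_mem_basicOpen x hxU] at hd
    obtain ⟨γ, hγ⟩ := exists_disc_ne_zero (T.evaluation U x hxU).hom hrkU hP hd
    refine ⟨γ, ?_⟩
    have h' := (T.evaluation_ne_zero_iff_mem_basicOpen x hxU _).1 hγ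
    rw [restrictRep, mapRep_apply, disc_map] at h'
    exact (mem_basicOpen_map _ _ hxU).1 h'
  · rintro ⟨h1, h2⟩
    refine ⟨fun x => ?_, fun x => ?_⟩
    · obtain ⟨γ, hγ⟩ := h2 x
      obtain ⟨u, hxu, hu⟩ : ∃ u : Γ(T, ⊤), x ∈ T.basicOpen u ∧
          (u = ρ γ 0 0 - ρ γ 1 1 ∨ u = ρ γ 0 1 ∨ u = ρ γ 1 0) := by
        by_contra! hc
        have a : ∀ u : Γ(T, ⊤), (u = ρ γ 0 0 - ρ γ 1 1 ∨ u = ρ γ 0 1 ∨ u = ρ γ 1 0) →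
            (T.evaluation ⊤ x trivial).hom u = 0 := fun u hu => by
          refine (T.evaluation_eq_zero_iff_notMem_basicOpen x (U := ⊤) trivial u).2 fun h' => ?_
          rcases hu with hu | hu | hu
          · exact (hc u h').1 hu
          · exact (hc u h').2.1 hu
          · exact (hc u h').2.2 hu
        refine (T.evaluation_ne_zero_iff_mem_basicOpen x (U := ⊤) trivial _).2 hγ ?_
        change (T.evaluation ⊤ x trivial).hom _ = 0
        rw [disc_eq, map_add, map_pow, map_mul, map_mul, a _ (Or.inl rfl),
          a _ (Or.inr (Or.inl rfl))]
        ring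
      obtain ⟨U, hU, hxU, hle⟩ := exists_isAffineOpen_mem_and_subset hxu
      have : Nonempty U := ⟨⟨x, hxU⟩⟩
      have hunit : IsUnit ((T.presheaf.map (homOfLE (le_top : U ≤ ⊤)).op).hom u) := by
        have h := (T.toLocallyRingedSpace.toRingedSpace.isUnit_res_basicOpen u).map
          (T.presheaf.map (homOfLE (show U ≤ T.basicOpen u from hle)).op).hom
        have e := T.presheaf.map_comp (homOfLE (le_top : T.basicOpen u ≤ ⊤)).op
          (homOfLE (show U ≤ T.basicOpen u from hle)).op
        have e' := congrArg (fun f => f.hom u) e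
        exact e' ▸ h
      refine ⟨U, hU, hxU, repAlgebra_free (fun α β γ r => ?_) γ ?_⟩
      · rw [restrictRep, tripleMinor_mapRep, h1, map_zero]
      · rcases hu with rfl | rfl | rfl
        · left; simpa [restrictRep] using hunit
        · right; left; exact hunit
        · right; right; exact hunit
    · obtain ⟨γ, hγ⟩ := h2 x
      obtain ⟨U, hU, hxU, -⟩ := exists_isAffineOpen_mem_and_subset (U := (⊤ : T.Opens))
        (x := x) trivial
      refine ⟨U, hU, hxU, restrictRep ρ U γ, Algebra.subset_adjoin ⟨γ, rfl⟩, ?_⟩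
      rw [restrictRep, mapRep_apply, disc_map]
      exact (mem_basicOpen_map _ _ hxU).2 hγ

end Molds

section Varieties

variable (Γ : Type u) [Monoid Γ]

/-- The affine scheme `Rep₂(Γ)_{rk ≤ 2}`. -/
abbrev RepRk : Scheme.{u} := Spec (.of (A₂rk Γ))

/-- The affine scheme `Ch₂(Γ)_{rk ≤ 2}`. -/
abbrev ChRk : Scheme.{u} := Spec (.of (A₂Ch Γ))

/-- The morphism `Rep₂(Γ)_{rk ≤ 2} → Ch₂(Γ)_{rk ≤ 2}` given by the inclusion of rings. -/
def piRk : RepRk Γ ⟶ ChRk Γ := Spec.map (CommRingCat.ofHom (A₂Ch Γ).subtype)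

/-- The open subset of `Rep₂(Γ)_{rk ≤ 2}` where some `m(σ_Γ(γ))` does not vanish. -/
def repSSOpen : (RepRk Γ).Opens :=
  ⨆ γ : Γ, (PrimeSpectrum.basicOpen (disc (univRepRk Γ γ)) : (Spec (.of (A₂rk Γ))).Opens)

/-- The open subset of `Ch₂(Γ)_{rk ≤ 2}` where some `m(σ_Γ(γ))` does not vanish. -/
def chSSOpen : (ChRk Γ).Opens :=
  ⨆ γ : Γ, (PrimeSpectrum.basicOpen (chDisc Γ γ) : (Spec (.of (A₂Ch Γ))).Opens)

theorem repSSOpen_le : repSSOpen Γ ≤ piRk Γ ⁻¹ᵁ chSSOpen Γ := by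
  refine iSup_le fun γ => ?_
  have h : (PrimeSpectrum.basicOpen (chDisc Γ γ) : (Spec (.of (A₂Ch Γ))).Opens) ≤ chSSOpen Γ :=
    le_iSup (fun γ : Γ =>
      (PrimeSpectrum.basicOpen (chDisc Γ γ) : (Spec (.of (A₂Ch Γ))).Opens)) γ
  exact fun x hx => h hx

/-- The representation variety with semi-simple mold `Rep₂(Γ)_{s.s.}`; it represents the functor
`repSSFunctor Γ`, see `repSSRepresentableBy`. -/
abbrev RepSS : Scheme.{u} := (repSSOpen Γ).toScheme

/-- The character variety with semi-simple mold `Ch₂(Γ)_{s.s.}`. -/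
abbrev ChSS : Scheme.{u} := (chSSOpen Γ).toScheme

/-- The canonical morphism `π_{Γ,s.s.} : Rep₂(Γ)_{s.s.} → Ch₂(Γ)_{s.s.}`. -/
def piSS : RepSS Γ ⟶ ChSS Γ :=
  (piRk Γ).resLE (chSSOpen Γ) (repSSOpen Γ) (repSSOpen_le Γ)

variable {Γ}

theorem HasSemisimpleMold.map {T T' : Scheme.{u}} {ρ : Γ →* Mat Γ(T, ⊤)}
    (h : HasSemisimpleMold ρ) (g : T' ⟶ T) : HasSemisimpleMold (mapRep g.appTop.hom ρ) := by
  rw [hasSemisimpleMold_iff] at h ⊢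
  refine ⟨fun α β γ r => ?_, fun x => ?_⟩
  · rw [tripleMinor_mapRep, h.1, map_zero]
  · obtain ⟨γ, hγ⟩ := h.2 (g x)
    refine ⟨γ, ?_⟩
    rw [mapRep_apply, disc_map]
    have := Scheme.preimage_basicOpen_top g (disc (ρ γ))
    exact this.le hγ

variable (Γ) in
/-- The functor `T ↦ {representations of degree 2 of Γ on T with semi-simple mold}`. -/
def repSSFunctor : Scheme.{u}ᵒᵖ ⥤ Type u where
  obj T := {ρ : Γ →* Mat Γ(T.unop, ⊤) // HasSemisimpleMold ρ}
  map g := ↾fun ρ => ⟨mapRep g.unop.appTop.hom ρ.1, ρ.2.map g.unop⟩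
  map_id T := by
    ext ρ : 3
    refine Subtype.ext ?_
    ext γ i j
    simp
  map_comp f g := by
    ext ρ : 3
    refine Subtype.ext ?_
    ext γ i j
    simp
    rfl

theorem range_subset_repSSOpen_iff {T : Scheme.{u}} (f : T ⟶ RepRk Γ) :
    Set.range f ⊆ Set.range (repSSOpen Γ).ι ↔
      ∀ x : T, ∃ γ, x ∈ T.basicOpen (disc ((rkEquiv (specPoints T (A₂rk Γ) f)).1 γ)) := by
  rw [Scheme.Opens.range_ι, Set.range_subset_iff]
  refine forall_congr' fun x => ?_
  rw [SetLike.mem_coe, repSSOpen]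
  refine TopologicalSpace.Opens.mem_iSup.trans ?_
  refine exists_congr fun γ => ?_
  have h := specPoints_preimage_basicOpen (A := A₂rk Γ) f (disc (univRepRk Γ γ))
  have h' : disc ((rkEquiv (specPoints T (A₂rk Γ) f)).1 γ) =
      specPoints T (A₂rk Γ) f (disc (univRepRk Γ γ)) := disc_map _ _
  rw [h', ← h]
  rfl

/-- `T`-valued points of `Rep₂(Γ)_{s.s.}` are representations on `T` with semi-simple mold. -/
def repSSEquiv (T : Scheme.{u}) :
    (T ⟶ RepSS Γ) ≃ {ρ : Γ →* Mat Γ(T, ⊤) // HasSemisimpleMold ρ} where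
  toFun g := ⟨(rkEquiv (specPoints T (A₂rk Γ) (g ≫ (repSSOpen Γ).ι))).1,
    (hasSemisimpleMold_iff _).2 ⟨(rkEquiv _).2, (range_subset_repSSOpen_iff _).1 (by
      rintro _ ⟨x, rfl⟩
      exact ⟨g x, rfl⟩)⟩⟩
  invFun ρ := IsOpenImmersion.lift (repSSOpen Γ).ι
    ((specPoints T (A₂rk Γ)).symm (rkEquiv.symm ⟨ρ.1, ((hasSemisimpleMold_iff _).1 ρ.2).1⟩))
    ((range_subset_repSSOpen_iff _).2 (by
      rw [Equiv.apply_symm_apply, Equiv.apply_symm_apply]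
      exact ((hasSemisimpleMold_iff _).1 ρ.2).2))
  left_inv g := by
    rw [← cancel_mono (repSSOpen Γ).ι, IsOpenImmersion.lift_fac, Equiv.symm_apply_eq,
      Equiv.symm_apply_eq]
  right_inv ρ := by
    refine Subtype.ext ?_
    dsimp only
    rw [IsOpenImmersion.lift_fac, Equiv.apply_symm_apply, Equiv.apply_symm_apply]

variable (Γ) in
/-- The scheme `Rep₂(Γ)_{s.s.}` represents the functor of representations with semi-simple mold. -/
def repSSRepresentableBy : (repSSFunctor Γ).RepresentableBy (RepSS Γ) where
  homEquiv {T} := repSSEquiv T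
  homEquiv_comp {T T'} f g := by
    refine Subtype.ext ?_
    change (rkEquiv (specPoints T (A₂rk Γ) ((f ≫ g) ≫ (repSSOpen Γ).ι))).1 =
      mapRep f.appTop.hom (rkEquiv (specPoints T' (A₂rk Γ) (g ≫ (repSSOpen Γ).ι))).1
    rw [Category.assoc]
    have := specPoints_comp (A := A₂rk Γ) f (g ≫ (repSSOpen Γ).ι)
    exact congrArg (fun φ : A₂rk Γ →+* Γ(T, ⊤) => (rkEquiv φ).1) this

end Varieties

section GroupScheme

/-- The group functor `T ↦ Aut_{𝒪_T-alg}(M₂(𝒪_T))`. -/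
def autFunctor : Scheme.{u}ᵒᵖ ⥤ GrpCat.{u} where
  obj T := GrpCat.of (Mat Γ(T.unop, ⊤) ≃ₐ[Γ(T.unop, ⊤)] Mat Γ(T.unop, ⊤))
  map g := GrpCat.ofHom (mapAut g.unop.appTop.hom)
  map_id T := by
    ext φ : 2
    exact mapAut_id φ
  map_comp f g := by
    ext φ : 2
    change mapAut (g.unop ≫ f.unop).appTop.hom φ = _
    rw [Scheme.Hom.comp_appTop]
    exact mapAut_mapAut _ _ φ

/-- The scheme `PGL₂` over `ℤ`. -/
def PGL₂ : Scheme.{u} := Spec (.of PGL₂Ring.{u})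

/-- `PGL₂` represents the functor of algebra automorphisms of `M₂`. -/
def PGL₂RepresentableBy : (autFunctor.{u} ⋙ forget GrpCat).RepresentableBy PGL₂.{u} where
  homEquiv {T} := (specPoints T PGL₂Ring.{u}).trans pointAutEquiv
  homEquiv_comp {T T'} f g := by
    change pointAutEquiv (specPoints T PGL₂Ring.{u} (f ≫ g)) =
      mapAut f.appTop.hom (pointAutEquiv (specPoints T' PGL₂Ring.{u} g))
    rw [← pointAutEquiv_comp]
    exact congrArg pointAutEquiv (specPoints_comp (A := PGL₂Ring.{u}) f g)

/-- The group scheme structure of `PGL₂`. -/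
instance : GrpObj PGL₂.{u} := GrpObj.ofRepresentableBy PGL₂ autFunctor PGL₂RepresentableBy

/-- The algebra automorphism of `M₂(Γ(T, 𝒪_T))` attached to a `T`-valued point of `PGL₂`. -/
def autOf {T : Scheme.{u}} (g : T ⟶ PGL₂.{u}) : Mat Γ(T, ⊤) ≃ₐ[Γ(T, ⊤)] Mat Γ(T, ⊤) :=
  PGL₂RepresentableBy.homEquiv g

theorem autOf_comp {T T' : Scheme.{u}} (f : T ⟶ T') (g : T' ⟶ PGL₂.{u}) :
    autOf (f ≫ g) = mapAut f.appTop.hom (autOf g) :=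
  PGL₂RepresentableBy.homEquiv_comp f g

theorem autOf_comp_one {T : Scheme.{u}} (f : T ⟶ 𝟙_ Scheme.{u}) :
    autOf (f ≫ MonObj.one (X := PGL₂.{u})) = 1 := by
  rw [autOf_comp]
  have : autOf (MonObj.one (X := PGL₂.{u})) = 1 :=
    PGL₂RepresentableBy.homEquiv.apply_symm_apply _
  rw [this, map_one]

theorem autOf_comp_mul {T : Scheme.{u}} (f : T ⟶ PGL₂.{u} ⊗ PGL₂.{u}) :
    autOf (f ≫ MonObj.mul (X := PGL₂.{u})) = autOf (f ≫ fst _ _) * autOf (f ≫ snd _ _) := by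
  rw [autOf_comp, autOf_comp, autOf_comp, ← map_mul]
  congr 1
  exact PGL₂RepresentableBy.homEquiv.apply_symm_apply _

variable {Γ : Type u} [Monoid Γ]

/-- The action of an algebra automorphism of `M₂(R)` on representations by composition. -/
def actRep {Δ R : Type*} [Monoid Δ] [CommRing R] (φ : Mat R ≃ₐ[R] Mat R) (ρ : Δ →* Mat R) :
    Δ →* Mat R :=
  (φ : Mat R →* Mat R).comp ρ

theorem HasSemisimpleMold.act {T : Scheme.{u}} {ρ : Γ →* Mat Γ(T, ⊤)} (h : HasSemisimpleMold ρ)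
    (φ : Mat Γ(T, ⊤) ≃ₐ[Γ(T, ⊤)] Mat Γ(T, ⊤)) : HasSemisimpleMold (actRep φ ρ) := by
  rw [hasSemisimpleMold_iff] at h ⊢
  refine ⟨fun α β γ r => ?_, fun x => ?_⟩
  · have := tripleMinor_linear φ.toLinearMap ![ρ α, ρ β, ρ γ] (h.1 α β γ) r
    rw [← this]
    congr 1
    ext j : 1
    fin_cases j <;> rfl
  · obtain ⟨γ, hγ⟩ := h.2 x
    refine ⟨γ, ?_⟩
    have : disc (actRep φ ρ γ) = disc (ρ γ) := disc_aut φ (ρ γ)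
    rwa [this]

/-- The representation attached to a `T`-valued point of `Rep₂(Γ)_{s.s.}`. -/
def repOf {T : Scheme.{u}} (x : T ⟶ RepSS Γ) : {ρ : Γ →* Mat Γ(T, ⊤) // HasSemisimpleMold ρ} :=
  (repSSRepresentableBy Γ).homEquiv x

theorem repOf_comp {T T' : Scheme.{u}} (f : T ⟶ T') (x : T' ⟶ RepSS Γ) :
    (repOf (f ≫ x)).1 = mapRep f.appTop.hom (repOf x).1 :=
  congrArg Subtype.val ((repSSRepresentableBy Γ).homEquiv_comp f x)

theorem repOf_injective {T : Scheme.{u}} {x y : T ⟶ RepSS Γ}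
    (h : (repOf x).1 = (repOf y).1) : x = y :=
  (repSSRepresentableBy Γ).homEquiv.injective (Subtype.ext h)

variable (Γ) in
/-- The action morphism `PGL₂ × Rep₂(Γ)_{s.s.} → Rep₂(Γ)_{s.s.}`: on points,
`(φ, ρ) ↦ φ ∘ ρ`, that is `ρ ↦ P ρ P⁻¹` for `φ` the conjugation by `P`. -/
def actMor : PGL₂.{u} ⊗ RepSS Γ ⟶ RepSS Γ :=
  (repSSRepresentableBy Γ).homEquiv.symm
    ⟨actRep (autOf (fst _ _)) (repOf (snd PGL₂.{u} (RepSS Γ))).1,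
      (repOf (snd PGL₂.{u} (RepSS Γ))).2.act _⟩

theorem repOf_lift_actMor {T : Scheme.{u}} (f : T ⟶ PGL₂.{u} ⊗ RepSS Γ) :
    (repOf (f ≫ actMor Γ)).1 = actRep (autOf (f ≫ fst _ _)) (repOf (f ≫ snd _ _)).1 := by
  rw [repOf_comp, repOf_comp, autOf_comp]
  have h : (repOf (actMor Γ)).1 =
      actRep (autOf (fst _ _)) (repOf (snd PGL₂.{u} (RepSS Γ))).1 :=
    congrArg Subtype.val ((repSSRepresentableBy Γ).homEquiv.apply_symm_apply _)
  rw [h]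
  ext γ : 1
  exact (mapAut_mapMatrix f.appTop.hom (autOf (fst PGL₂ (RepSS Γ)))
    ((repOf (snd PGL₂ (RepSS Γ))).1 γ)).symm

/-- The action of the group scheme `PGL₂` on `Rep₂(Γ)_{s.s.}`. -/
instance : ModObj PGL₂.{u} (RepSS Γ) where
  smul := actMor Γ
  one_smul := by
    change MonObj.one (X := PGL₂.{u}) ▷ RepSS Γ ≫ actMor Γ = (λ_ (RepSS Γ)).hom
    apply repOf_injective
    rw [repOf_lift_actMor, whiskerRight_fst, whiskerRight_snd, autOf_comp_one, leftUnitor_hom]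
    rfl
  mul_smul := by
    change MonObj.mul (X := PGL₂.{u}) ▷ RepSS Γ ≫ actMor Γ =
      (α_ PGL₂ PGL₂ (RepSS Γ)).hom ≫ PGL₂ ◁ actMor Γ ≫ actMor Γ
    apply repOf_injective
    rw [repOf_lift_actMor, whiskerRight_fst, whiskerRight_snd, autOf_comp_mul]
    rw [← Category.assoc, repOf_lift_actMor, Category.assoc, whiskerLeft_fst, Category.assoc,
      whiskerLeft_snd, ← Category.assoc _ _ (actMor Γ), repOf_lift_actMor]
    simp only [Category.assoc, associator_hom_fst, associator_hom_snd_fst, associator_hom_snd_snd]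
    rfl

end GroupScheme

section GeometricQuotient

variable {G X Y : Scheme.{u}} [GrpObj G] [ModObj G X]

/-- The action morphism `σ : G × X → X`. -/
abbrev actionMap (G X : Scheme.{u}) [GrpObj G] [ModObj G X] : G ⊗ X ⟶ X :=
  ModObj.smul (M := G) (X := X)

/-- `φ : X → Y` is a geometric quotient of `X` by the action `σ` of the group scheme `G` over `ℤ`. -/
structure IsGeometricQuotient (G : Scheme.{u}) {X Y : Scheme.{u}} [GrpObj G] [ModObj G X]
    (φ : X ⟶ Y) : Prop where
  /-- `φ ∘ σ = φ ∘ p₂`. -/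
  invariant : actionMap G X ≫ φ = snd G X ≫ φ
  /-- `φ` is surjective. -/
  surjective : Function.Surjective φ
  /-- The image of `(σ, p₂) : G × X → X × X` is `X ×_Y X`. -/
  range_eq : Set.range (lift (actionMap G X) (snd G X)) =
    Set.range (lift (pullback.fst φ φ) (pullback.snd φ φ))
  /-- `φ` is submersive: a subset of `Y` is open if and only if its preimage in `X` is open. -/
  submersive : ∀ U : Set Y, IsOpen U ↔ IsOpen (φ ⁻¹' U)
  /-- `𝒪_Y → φ_* 𝒪_X` is injective. -/
  injective : ∀ U : Y.Opens, Function.Injective (φ.app U).hom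
  /-- The image of `𝒪_Y → φ_* 𝒪_X` consists of the invariant functions. -/
  mem_range_iff : ∀ (U : Y.Opens) (f : Γ(X, φ ⁻¹ᵁ U)),
    f ∈ Set.range (φ.app U).hom ↔
      ((actionMap G X).appLE (φ ⁻¹ᵁ U) ((snd G X ≫ φ) ⁻¹ᵁ U)
        (by rw [← invariant]; exact le_rfl)).hom f =
      ((snd G X).appLE (φ ⁻¹ᵁ U) ((snd G X ≫ φ) ⁻¹ᵁ U) le_rfl).hom f

/-- For an invariant `φ : X → Y` and `b : Y' → Y`, the induced action of `G` on `X ×_Y Y'`,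
namely `(g, (x, y')) ↦ (g x, y')`. -/
@[reducible] def baseChangeAction {φ : X ⟶ Y} (h : actionMap G X ≫ φ = snd G X ≫ φ)
    {Y' : Scheme.{u}} (b : Y' ⟶ Y) : ModObj G (pullback φ b) where
  smul := pullback.lift (G ◁ pullback.fst φ b ≫ actionMap G X)
    (snd G (pullback φ b) ≫ pullback.snd φ b) (by
      rw [Category.assoc, h, whiskerLeft_snd_assoc, Category.assoc, pullback.condition])
  one_smul := by
    change MonObj.one (X := G) ▷ pullback φ b ≫ _ = (λ_ _).hom
    apply pullback.hom_ext
    · rw [Category.assoc, pullback.lift_fst, ← whisker_exchange_assoc]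
      have := ModObj.one_smul (M := G) X
      change MonObj.one (X := G) ▷ X ≫ actionMap G X = (λ_ X).hom at this
      rw [this, leftUnitor_hom, whiskerLeft_snd, leftUnitor_hom]
    · rw [Category.assoc, pullback.lift_snd, whiskerRight_snd_assoc, leftUnitor_hom]
  mul_smul := by
    change MonObj.mul (X := G) ▷ pullback φ b ≫ _ = (α_ _ _ _).hom ≫ G ◁ _ ≫ _
    apply pullback.hom_ext
    · simp only [Category.assoc, pullback.lift_fst]
      rw [← whisker_exchange_assoc]
      have := ModObj.mul_smul (M := G) X
      change MonObj.mul (X := G) ▷ X ≫ actionMap G X =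
        (α_ G G X).hom ≫ G ◁ actionMap G X ≫ actionMap G X at this
      rw [this, ← MonoidalCategory.whiskerLeft_comp_assoc, pullback.lift_fst]
      simp
    · simp only [Category.assoc, pullback.lift_snd, whiskerRight_snd_assoc,
        whiskerLeft_snd_assoc, associator_hom_snd_snd_assoc]

/-- `φ : X → Y` is a universal geometric quotient of `X` by the group scheme `G`: for every
morphism `b : Y' → Y`, the projection `X ×_Y Y' → Y'` is a geometric quotient by `G`. -/
def IsUniversalGeometricQuotient (G : Scheme.{u}) {X Y : Scheme.{u}} [GrpObj G] [ModObj G X]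
    (φ : X ⟶ Y) : Prop :=
  ∃ h : actionMap G X ≫ φ = snd G X ≫ φ, ∀ (Y' : Scheme.{u}) (b : Y' ⟶ Y),
    letI : ModObj G (pullback φ b) := baseChangeAction h b
    IsGeometricQuotient G (pullback.snd φ b)

end GeometricQuotient

end

end TwoDimRep

/-!
The morphism `π_{Γ,s.s.}` has two properties that are visibly stable under base change and together
imply that it is a geometric quotient.

* It has sections Zariski-locally on the target (`hasLocalSections_piSS`). Where `m(σ(γ))` is
  invertible, every `σ(α)` is a combination `a(α) + b(α) σ(γ)` whose coefficients are given by traces,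
  hence lie in the localized ring of traces and determinants. Replacing `σ(γ)` by the companion matrix
  of its characteristic polynomial gives a representation over that ring with the same traces and
  determinants (`RankLETwo.exists_descent`).
* `PGL₂` acts transitively on its fibres, Zariski-locally (`isLocallyTransitive_piSS`). A `2 × 2`
  matrix whose discriminant is nonzero at a point has a cyclic vector near this point, so it is
  conjugate there to its companion matrix. For two representations `ρ₁, ρ₂` with the same traces and
  determinants, `ρ₁ γ` and `ρ₂ γ` are therefore conjugate near every point where `m(ρ₁ γ) ≠ 0`; the
  trace formulas for the coefficients show that the same conjugation takes `ρ₂` to `ρ₁`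
  (`RankLETwo.exists_actRep_eq`).

That these two properties suffice is `isGeometricQuotient_of_hasLocalSections`. The only point needing
an argument is that invariant functions descend: such a function takes equal values on two points of
the source with the same image, so its pullbacks along local sections agree on overlaps and glue.
-/

namespace TwoDimRep

section Algebra

variable {R S : Type*} [CommRing R] [CommRing S] {Γ : Type*} [Monoid Γ]

/-! ### Algebra automorphisms and conjugation -/

/-- Taking traces in the Cayley–Hamilton identity would only determine twice the determinant;
comparing the identity itself for `Y` and `φ Y` gives the determinant over every ring. -/
theorem det_aut (φ : Mat R ≃ₐ[R] Mat R) (Y : Mat R) : (φ Y).det = Y.det := by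
  have ch : ∀ A : Mat R, A * A - A.trace • A = -(A.det • (1 : Mat R)) := fun A => by
    ext i j
    fin_cases i <;> fin_cases j <;>
      simp [Matrix.mul_apply, Fin.sum_univ_two, Matrix.trace_fin_two, Matrix.det_fin_two] <;> ring
  have h := congrArg φ (ch Y)
  rw [map_sub, map_mul, map_smul, map_neg, map_smul, map_one, ← trace_aut φ Y, ch, neg_inj] at h
  simpa using congrFun (congrFun h 0) 0

/-- Conjugation by an invertible matrix, given together with its inverse. -/
def conjAut (M N : Mat R) (h : M * N = 1) : Mat R ≃ₐ[R] Mat R :=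
  have h' : N * M = 1 := mul_eq_one_comm.1 h
  AlgEquiv.ofAlgHom
    (AlgHom.ofLinearMap ((LinearMap.mulLeft R M).comp (LinearMap.mulRight R N)) (by simp [h])
      fun X Y => by
        simp only [LinearMap.comp_apply, LinearMap.mulLeft_apply, LinearMap.mulRight_apply]
        rw [show M * (X * N) * (M * (Y * N)) = M * (X * (N * M) * (Y * N)) by noncomm_ring, h']
        noncomm_ring)
    (AlgHom.ofLinearMap ((LinearMap.mulLeft R N).comp (LinearMap.mulRight R M)) (by simp [h'])
      fun X Y => by
        simp only [LinearMap.comp_apply, LinearMap.mulLeft_apply, LinearMap.mulRight_apply]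
        rw [show N * (X * M) * (N * (Y * M)) = N * (X * (M * N) * (Y * M)) by noncomm_ring, h]
        noncomm_ring)
    (by
      ext X : 1
      change M * (N * (X * M) * N) = X
      rw [show M * (N * (X * M) * N) = (M * N) * X * (M * N) by noncomm_ring, h]
      simp)
    (by
      ext X : 1
      change N * (M * (X * N) * M) = X
      rw [show N * (M * (X * N) * M) = (N * M) * X * (N * M) by noncomm_ring, h']
      simp)

theorem conjAut_apply (M N : Mat R) (h : M * N = 1) (X : Mat R) :
    conjAut M N h X = M * (X * N) := rfl

/-! ### Cyclic vectors -/

/-- The companion matrix of the polynomial `X² - t X + d`. -/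
def companion (t d : R) : Mat R := !![0, -d; 1, t]

/-- The matrix with columns `v` and `P v`, where `v = (x, y)`. -/
def cyclicMatrix (P : Mat R) (x y : R) : Mat R :=
  !![x, P 0 0 * x + P 0 1 * y; y, P 1 0 * x + P 1 1 * y]

theorem mul_cyclicMatrix (P : Mat R) (x y : R) :
    P * cyclicMatrix P x y = cyclicMatrix P x y * companion P.trace P.det := by
  ext i j
  fin_cases i <;> fin_cases j <;>
    simp [cyclicMatrix, companion, Matrix.mul_apply, Fin.sum_univ_two, Matrix.trace_fin_two,
      Matrix.det_fin_two] <;> ring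

theorem det_cyclicMatrix_map (f : R →+* S) (P : Mat R) (x y : R) :
    (cyclicMatrix (f.mapMatrix P) (f x) (f y)).det = f (cyclicMatrix P x y).det := by
  simp [cyclicMatrix, Matrix.det_fin_two]

/-- A matrix whose discriminant is nonzero in a field `K` has, over `K`, a cyclic vector with
entries `0` or `1`. -/
theorem exists_det_cyclicMatrix_ne_zero {K : Type*} [Field K] (f : R →+* K) (P : Mat R)
    (h : f (disc P) ≠ 0) : ∃ x y : R, f (cyclicMatrix P x y).det ≠ 0 := by
  by_contra! hc
  apply h
  have h1 := hc 1 0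
  have h2 := hc 0 1
  have h3 := hc 1 1
  simp only [cyclicMatrix, Matrix.det_fin_two_of] at h1 h2 h3
  simp only [disc_eq, map_add, map_sub, map_mul, map_pow, mul_one, mul_zero,
    one_mul, zero_mul, add_zero, zero_add, sub_zero, zero_sub, map_ofNat, map_neg] at h1 h2 h3 ⊢
  linear_combination (f (P 0 0) - f (P 1 1)) * (h1 + h2 - h3) + 4 * f (P 0 1) * h1

/-- Two matrices with cyclic vectors and the same characteristic polynomial are conjugate, both
being conjugate to the companion matrix. -/
theorem exists_aut_apply_eq {P Q : Mat R} (ht : P.trace = Q.trace) (hd : P.det = Q.det)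
    {x y z w : R} (hP : IsUnit (cyclicMatrix P x y).det) (hQ : IsUnit (cyclicMatrix Q z w).det) :
    ∃ φ : Mat R ≃ₐ[R] Mat R, φ Q = P := by
  set M := cyclicMatrix P x y with hM
  set N := cyclicMatrix Q z w with hN
  have h1 : P * M = M * companion P.trace P.det := mul_cyclicMatrix P x y
  have h2 : Q * N = N * companion P.trace P.det := by rw [ht, hd]; exact mul_cyclicMatrix Q z w
  refine ⟨conjAut (M * N⁻¹) (N * M⁻¹) ?_, ?_⟩
  · rw [mul_assoc, Matrix.nonsing_inv_mul_cancel_left _ _ hQ, Matrix.mul_nonsing_inv _ hP]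
  · rw [conjAut_apply, ← mul_assoc Q, h2, mul_assoc, mul_assoc N,
      Matrix.nonsing_inv_mul_cancel_left _ _ hQ, ← mul_assoc, ← h1, mul_assoc,
      Matrix.mul_nonsing_inv _ hP, mul_one]

/-! ### Representations of rank at most two and their traces -/

/-- The trace formulas, up to the factor `m(ρ γ)`, for the coefficients of `ρ α` in terms of
`1` and `ρ γ`. -/
theorem RankLETwo.disc_smul_eq {ρ : Γ →* Mat R} (h : RankLETwo ρ) (γ α : Γ) :
    disc (ρ γ) • ρ α =
      (((ρ γ).trace ^ 2 - 2 * (ρ γ).det) * (ρ α).trace - (ρ γ).trace * (ρ (α * γ)).trace) •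
          (1 : Mat R) +
        (2 * (ρ (α * γ)).trace - (ρ γ).trace * (ρ α).trace) • ρ γ := by
  have hp := h.parallel α γ
  have h12 := hp.h12
  have h01 := hp.h01
  have h02 := hp.h02
  rw [map_mul]
  ext i j
  fin_cases i <;> fin_cases j <;>
    simp [disc, Matrix.mul_apply, Fin.sum_univ_two, Matrix.trace_fin_two, Matrix.det_fin_two]
  · linear_combination ρ γ 1 0 * h01 + ρ γ 0 1 * h02
  · linear_combination -(ρ γ 0 0 - ρ γ 1 1) * h01 + 2 * ρ γ 0 1 * h12
  · linear_combination -(ρ γ 0 0 - ρ γ 1 1) * h02 - 2 * ρ γ 1 0 * h12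
  · linear_combination -ρ γ 1 0 * h01 - ρ γ 0 1 * h02

/-- Two representations of rank at most two with the same traces and determinants are conjugate as
soon as some `ρ γ` and `ρ' γ` have cyclic vectors and invertible discriminant: an automorphism
taking `ρ' γ` to `ρ γ` takes `ρ'` to `ρ`, the coefficients with respect to `1, ρ γ` being
determined by the traces. -/
theorem RankLETwo.exists_actRep_eq {ρ ρ' : Γ →* Mat R} (h : RankLETwo ρ) (h' : RankLETwo ρ')
    (ht : ∀ α, (ρ α).trace = (ρ' α).trace) (hd : ∀ α, (ρ α).det = (ρ' α).det) (γ : Γ)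
    (hu : IsUnit (disc (ρ γ))) {x y z w : R} (hv : IsUnit (cyclicMatrix (ρ γ) x y).det)
    (hv' : IsUnit (cyclicMatrix (ρ' γ) z w).det) :
    ∃ φ : Mat R ≃ₐ[R] Mat R, actRep φ ρ' = ρ := by
  obtain ⟨φ, hφ⟩ := exists_aut_apply_eq (ht γ) (hd γ) hv hv'
  refine ⟨φ, MonoidHom.ext fun α => ?_⟩
  change φ (ρ' α) = ρ α
  refine hu.smul_left_cancel.1 ?_
  have hdisc : disc (ρ γ) = disc (ρ' γ) := by rw [disc, disc, ht, hd]
  rw [h.disc_smul_eq, ← map_smul, hdisc, h'.disc_smul_eq, map_add, map_smul, map_smul, map_one, hφ]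
  simp only [ht, hd]

theorem eq_zero_of_smul_one_add_smul_eq_zero {P : Mat R} (hu : IsUnit (disc P)) {s t : R}
    (h : s • (1 : Mat R) + t • P = 0) : s = 0 ∧ t = 0 := by
  have e00 : s + t * P 0 0 = 0 := by simpa using congrFun (congrFun h 0) 0
  have e01 : t * P 0 1 = 0 := by simpa using congrFun (congrFun h 0) 1
  have e11 : s + t * P 1 1 = 0 := by simpa using congrFun (congrFun h 1) 1
  have ht : t = 0 := by
    refine (hu.mul_left_eq_zero).1 ?_
    rw [disc_eq]
    linear_combination (P 0 0 - P 1 1) * (e00 - e11) + 4 * P 1 0 * e01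
  subst ht
  exact ⟨by simpa using e00, rfl⟩

/-- A representation of rank at most two over an extension ring `S` of `R`, with traces and
determinants in `R` and `m(ρ γ)` invertible in `R`, has the same traces and determinants as a
representation over `R`, the one sending `γ` to a companion matrix. The coefficients of `ρ α`
with respect to `1, ρ γ` lie in `R`, and the same combinations of `1` and the companion matrix
give a representation because the two matrices satisfy the same quadratic equation. -/
theorem RankLETwo.exists_descent (f : R →+* S) (hf : Function.Injective f) {ρ : Γ →* Mat S}
    (h : RankLETwo ρ) {t d : Γ → R} (ht : ∀ α, f (t α) = (ρ α).trace)
    (hd : ∀ α, f (d α) = (ρ α).det) (γ : Γ) (hu : IsUnit (t γ ^ 2 - 4 * d γ)) :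
    ∃ ρ' : Γ →* Mat R, RankLETwo ρ' ∧ (∀ α, (ρ' α).trace = t α) ∧ ∀ α, (ρ' α).det = d α := by
  obtain ⟨v, hv⟩ := hu.exists_left_inv
  have hdisc : f (t γ ^ 2 - 4 * d γ) = disc (ρ γ) := by
    rw [disc, ← ht, ← hd, map_sub, map_mul, map_pow, map_ofNat]
  have hu' : IsUnit (disc (ρ γ)) := hdisc ▸ hu.map f
  -- the coefficients of `ρ α` in terms of `1` and `ρ γ`
  obtain ⟨a, b, hab⟩ : ∃ a b : Γ → R, ∀ α, ρ α = f (a α) • (1 : Mat S) + f (b α) • ρ γ := by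
    refine ⟨fun α => v * ((t γ ^ 2 - 2 * d γ) * t α - t γ * t (α * γ)),
      fun α => v * (2 * t (α * γ) - t γ * t α), fun α => ?_⟩
    refine hu'.smul_left_cancel.1 ?_
    have hv' : disc (ρ γ) * f v = 1 := by rw [← hdisc, ← map_mul, mul_comm, hv, map_one]
    rw [h.disc_smul_eq, smul_add, smul_smul, smul_smul, map_mul f v, map_mul f v, ← mul_assoc,
      ← mul_assoc, hv', one_mul, one_mul]
    simp only [map_sub, map_mul, map_pow, map_ofNat, ht, hd]
  have uniq : ∀ {x y x' y' : R}, f x • (1 : Mat S) + f y • ρ γ = f x' • (1 : Mat S) + f y' • ρ γ →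
      x = x' ∧ y = y' := fun {x y x' y'} e => by
    have := eq_zero_of_smul_one_add_smul_eq_zero hu' (s := f x - f x') (t := f y - f y') (by
      rw [sub_smul, sub_smul]
      rw [← sub_eq_zero] at e
      rw [← e]
      abel)
    exact ⟨hf (sub_eq_zero.1 this.1), hf (sub_eq_zero.1 this.2)⟩
  have h1 : a 1 = 1 ∧ b 1 = 0 := uniq (by rw [← hab, map_one, map_one, map_zero]; simp)
  have ch : ρ γ * ρ γ = f (t γ) • ρ γ - f (d γ) • (1 : Mat S) := by
    rw [ht, hd]
    ext i j
    fin_cases i <;> fin_cases j <;>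
      simp [Matrix.mul_apply, Fin.sum_univ_two, Matrix.trace_fin_two, Matrix.det_fin_two] <;> ring
  have hmul : ∀ α β, a (α * β) = a α * a β - b α * b β * d γ ∧
      b (α * β) = a α * b β + b α * a β + b α * b β * t γ := fun α β => uniq (by
    rw [← hab, map_mul, hab α, hab β]
    simp only [mul_add, add_mul, smul_mul_smul_comm, ch, one_mul, mul_one, map_add, map_sub,
      map_mul]
    module)
  have hdet : ∀ A : Mat S, ∀ x y : S, (x • (1 : Mat S) + y • A).det =
      x ^ 2 + x * y * A.trace + y ^ 2 * A.det := fun A x y => by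
    simp [Matrix.det_fin_two, Matrix.trace_fin_two]
    ring
  refine ⟨{ toFun := fun α => a α • (1 : Mat R) + b α • companion (t γ) (d γ)
            map_one' := by rw [h1.1, h1.2]; simp
            map_mul' := fun α β => ?_ }, ?_, fun α => hf ?_, fun α => hf ?_⟩
  · rw [(hmul α β).1, (hmul α β).2]
    ext i j
    fin_cases i <;> fin_cases j <;> simp [companion, Matrix.mul_apply, Fin.sum_univ_two] <;> ring
  · intro α β δ r
    rw [tripleMinor, Matrix.det_fin_three]
    simp [tripleMatrix]
    ring
  · rw [ht, hab α]
    simp only [companion, Matrix.trace_fin_two, Matrix.add_apply, Matrix.smul_apply,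
      Matrix.one_apply, smul_eq_mul, map_add]
    simp [ht, Matrix.trace_fin_two]
    ring
  · rw [hd, hab α, hdet]
    simp [companion, Matrix.det_fin_two, ht, hd]
    ring

/-- Descent to a ring of traces and determinants, after inverting `m(ρ γ)` in it. -/
theorem RankLETwo.exists_rep_localizationAway (g : R →+* S) (hg : Function.Injective g)
    {ρ : Γ →* Mat S} (h : RankLETwo ρ) {t d : Γ → R} (ht : ∀ α, g (t α) = (ρ α).trace)
    (hd : ∀ α, g (d α) = (ρ α).det) {γ : Γ} {e : R} (he : e = t γ ^ 2 - 4 * d γ) :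
    ∃ ρ' : Γ →* Mat (Localization.Away e), RankLETwo ρ' ∧
      (∀ α, (ρ' α).trace = algebraMap R _ (t α)) ∧ ∀ α, (ρ' α).det = algebraMap R _ (d α) := by
  let M := Submonoid.powers e
  let L := Localization (M.map g)
  let f : Localization.Away e →+* L := IsLocalization.map L g M.le_comap_map
  have hf : Function.Injective f := IsLocalization.map_injective_of_injective M _ L hg
  have hfa : ∀ a : R, f (algebraMap R _ a) = algebraMap S L (g a) := fun a =>
    IsLocalization.map_eq _ a
  have hrk : RankLETwo (mapRep (algebraMap S L) ρ) := fun α β δ r => by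
    rw [tripleMinor_mapRep, h, map_zero]
  refine hrk.exists_descent f hf (fun α => ?_) (fun α => ?_) γ ?_
  · rw [hfa, ht]
    exact AddMonoidHom.map_trace (algebraMap S L).toAddMonoidHom (ρ α)
  · rw [hfa, hd]
    exact RingHom.map_det _ (ρ α)
  · have := IsLocalization.Away.algebraMap_isUnit (S := Localization.Away e) e
    rw [he] at this ⊢
    rwa [map_sub, map_mul, map_pow, map_ofNat] at this

end Algebra

section Sections

variable {X Y : Scheme.{u}}

/-! ### Functions on open subschemes -/

theorem appLE_eq_of_eq {x y : X ⟶ Y} (h : x = y) {U : Y.Opens} {V : X.Opens} (e : V ≤ x ⁻¹ᵁ U)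
    (e' : V ≤ y ⁻¹ᵁ U) : x.appLE U V e = y.appLE U V e' := by
  subst h; rfl

theorem le_comp_preimage {Z : Scheme.{u}} {f : X ⟶ Y} {g : Y ⟶ Z} {U : Z.Opens} {V : Y.Opens}
    {W : X.Opens} (e₁ : V ≤ g ⁻¹ᵁ U) (e₂ : W ≤ f ⁻¹ᵁ V) : W ≤ (f ≫ g) ⁻¹ᵁ U :=
  e₂.trans fun _ hx => e₁ hx

theorem appLE_appLE {Z : Scheme.{u}} (f : X ⟶ Y) (g : Y ⟶ Z) {U : Z.Opens} {V : Y.Opens}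
    {W : X.Opens} (e₁ : V ≤ g ⁻¹ᵁ U) (e₂ : W ≤ f ⁻¹ᵁ V) (s : Γ(Z, U)) :
    (f.appLE V W e₂).hom ((g.appLE U V e₁).hom s) =
      ((f ≫ g).appLE U W (le_comp_preimage e₁ e₂)).hom s := by
  rw [← Scheme.Hom.appLE_comp_appLE f g U V W e₁ e₂]; rfl

theorem top_le_comp_preimage {Z : Scheme.{u}} (f : X ⟶ Y) {g : Y ⟶ Z} {U : Z.Opens}
    (e : ⊤ ≤ g ⁻¹ᵁ U) : ⊤ ≤ (f ≫ g) ⁻¹ᵁ U :=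
  le_comp_preimage e fun _ _ => trivial

theorem appTop_appLE {Z : Scheme.{u}} (f : X ⟶ Y) (g : Y ⟶ Z) {U : Z.Opens}
    (e : ⊤ ≤ g ⁻¹ᵁ U) (s : Γ(Z, U)) :
    f.appTop.hom ((g.appLE U ⊤ e).hom s) =
      ((f ≫ g).appLE U ⊤ (top_le_comp_preimage f e)).hom s := by
  have h := appLE_appLE f g e (le_refl (f ⁻¹ᵁ ⊤)) s
  rw [Scheme.Hom.appLE_eq_app] at h
  exact h

theorem exists_ι_eq {U : X.Opens} {x : X} (hx : x ∈ U) : ∃ u : U.toScheme, U.ι u = x :=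
  ⟨⟨x, hx⟩, rfl⟩

theorem top_le_ι_preimage {U V : X.Opens} (h : U ≤ V) : ⊤ ≤ U.ι ⁻¹ᵁ V := fun x _ => h x.2

/-- Functions on the open subset `U` of `X` are global functions on the open subscheme `U`, although
the two rings are not definitionally equal; the bijection is pullback along the inclusion. -/
theorem bijective_ι_appLE (U : X.Opens) :
    Function.Bijective (U.ι.appLE U ⊤ (top_le_ι_preimage le_rfl)).hom :=
  ConcreteCategory.bijective_of_isIso (U.ι.appLE U ⊤ U.ι_preimage_self.ge)

theorem ι_appLE_map {W U V : X.Opens} (hWU : W ≤ U) (hUV : U ≤ V) (s : Γ(X, V)) :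
    (W.ι.appLE U ⊤ (top_le_ι_preimage hWU)).hom ((X.presheaf.map (homOfLE hUV).op).hom s) =
      (W.ι.appLE V ⊤ (top_le_ι_preimage (hWU.trans hUV))).hom s := by
  rw [← Scheme.Hom.map_appLE W.ι (top_le_ι_preimage hWU) (homOfLE hUV).op]; rfl

/-- Functions on an open subset agree if they agree on a neighbourhood of each point. -/
theorem section_ext_of_ι_appLE {U : X.Opens} {f g : Γ(X, U)}
    (h : ∀ x ∈ U, ∃ (W : X.Opens) (hW : W ≤ U), x ∈ W ∧
      (W.ι.appLE U ⊤ (top_le_ι_preimage hW)).hom f =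
        (W.ι.appLE U ⊤ (top_le_ι_preimage hW)).hom g) : f = g := by
  choose W hW hx he using h
  refine TopCat.Sheaf.eq_of_locally_eq' X.sheaf (fun x : U => W x.1 x.2) U
    (fun x => homOfLE (hW x.1 x.2))
    (fun x hxU => TopologicalSpace.Opens.mem_iSup.2 ⟨⟨x, hxU⟩, hx x hxU⟩) f g fun x => ?_
  refine (bijective_ι_appLE (W x.1 x.2)).1 ?_
  exact (ι_appLE_map le_rfl (hW x.1 x.2) f).trans
    ((he x.1 x.2).trans (ι_appLE_map le_rfl (hW x.1 x.2) g).symm)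

/-- Compatible functions on the members of an open cover, given on the open subschemes, glue. -/
theorem exists_section_of_ι_appLE {I : Type u} (W : I → X.Opens) {U : X.Opens} (hW : ∀ i, W i ≤ U)
    (hU : U ≤ ⨆ i, W i) (s : ∀ i, Γ((W i).toScheme, ⊤))
    (hs : ∀ i j, ((X.homOfLE (inf_le_left : W i ⊓ W j ≤ W i)).appTop).hom (s i) =
      ((X.homOfLE (inf_le_right : W i ⊓ W j ≤ W j)).appTop).hom (s j)) :
    ∃ h : Γ(X, U), ∀ i, ((W i).ι.appLE U ⊤ (top_le_ι_preimage (hW i))).hom h = s i := by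
  choose t ht using fun i => (bijective_ι_appLE (W i)).2 (s i)
  have key : ∀ {V V' : X.Opens} (hV : V ≤ V') (a : Γ(X, V')),
      (V.ι.appLE V ⊤ (top_le_ι_preimage le_rfl)).hom ((X.presheaf.map (homOfLE hV).op).hom a) =
        ((X.homOfLE hV).appTop).hom ((V'.ι.appLE V' ⊤ (top_le_ι_preimage le_rfl)).hom a) := by
    intro V V' hV a
    rw [ι_appLE_map le_rfl hV]
    rw [appTop_appLE,
      appLE_eq_of_eq (X.homOfLE_ι hV) _ (top_le_ι_preimage hV)]
  obtain ⟨h, hh, -⟩ := TopCat.Sheaf.existsUnique_gluing' X.sheaf W U (fun i => homOfLE (hW i)) hU t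
    (fun i j => by
      refine (bijective_ι_appLE (W i ⊓ W j)).1 ?_
      refine (key inf_le_left (t i)).trans (Eq.trans ?_ (key inf_le_right (t j)).symm)
      rw [ht, ht, hs])
  refine ⟨h, fun i => ?_⟩
  rw [← ht i]
  exact (ι_appLE_map le_rfl (hW i) h).symm.trans (congrArg _ (hh i))

end Sections

section Criterion

/-! ### A criterion for universal geometric quotients -/

variable {G X Y : Scheme.{u}} [GrpObj G] [ModObj G X]

/-- The morphism `φ` has sections Zariski-locally on its target. -/
def HasLocalSections (φ : X ⟶ Y) : Prop :=
  ∀ y : Y, ∃ (V : Y.Opens) (_ : y ∈ V) (s : V.toScheme ⟶ X), s ≫ φ = V.ι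

/-- The group scheme `G` acts transitively on the fibres of `φ`, Zariski-locally: two `T`-valued
points of `X` with the same image in `Y` differ, locally on `T`, by the action of a point of `G`. -/
def IsLocallyTransitive (G : Scheme.{u}) {X Y : Scheme.{u}} [GrpObj G] [ModObj G X]
    (φ : X ⟶ Y) : Prop :=
  ∀ (T : Scheme.{u}) (x₁ x₂ : T ⟶ X), x₁ ≫ φ = x₂ ≫ φ → ∀ t : T,
    ∃ (W : T.Opens) (_ : t ∈ W) (g : W.toScheme ⟶ G),
      lift g (W.ι ≫ x₂) ≫ actionMap G X = W.ι ≫ x₁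

variable {φ : X ⟶ Y}

/-- An invariant function takes the same value on points of `X` with the same image in `Y`. -/
theorem IsLocallyTransitive.appLE_eq (ht : IsLocallyTransitive G φ)
    {U : Y.Opens} {f : Γ(X, φ ⁻¹ᵁ U)}
    {O : (G ⊗ X).Opens} {e₁ : O ≤ actionMap G X ⁻¹ᵁ φ ⁻¹ᵁ U} {e₂ : O ≤ snd G X ⁻¹ᵁ φ ⁻¹ᵁ U}
    (hO : (snd G X ≫ φ) ⁻¹ᵁ U ≤ O)
    (hf : ((actionMap G X).appLE (φ ⁻¹ᵁ U) O e₁).hom f = ((snd G X).appLE (φ ⁻¹ᵁ U) O e₂).hom f)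
    {T : Scheme.{u}} (x₁ x₂ : T ⟶ X) (hx : x₁ ≫ φ = x₂ ≫ φ)
    (h₁ : ⊤ ≤ x₁ ⁻¹ᵁ φ ⁻¹ᵁ U) (h₂ : ⊤ ≤ x₂ ⁻¹ᵁ φ ⁻¹ᵁ U) :
    (x₁.appLE (φ ⁻¹ᵁ U) ⊤ h₁).hom f = (x₂.appLE (φ ⁻¹ᵁ U) ⊤ h₂).hom f := by
  refine section_ext_of_ι_appLE fun t _ => ?_
  obtain ⟨W, htW, g, hg⟩ := ht T x₁ x₂ hx t
  refine ⟨W, le_top, htW, ?_⟩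
  rw [appLE_appLE, appLE_appLE]
  have hl : ⊤ ≤ lift g (W.ι ≫ x₂) ⁻¹ᵁ O := by
    refine le_trans ?_ (Scheme.Hom.preimage_mono _ hO)
    change ⊤ ≤ (lift g (W.ι ≫ x₂) ≫ snd G X ≫ φ) ⁻¹ᵁ U
    rw [lift_snd_assoc]
    exact fun w _ => h₂ (x := W.ι w) trivial
  have := congrArg ((lift g (W.ι ≫ x₂)).appLE O ⊤ hl).hom hf
  rw [appLE_appLE, appLE_appLE] at this
  rw [appLE_eq_of_eq hg.symm _ (le_comp_preimage e₁ hl), this, appLE_eq_of_eq (lift_snd _ _)]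

/-- A morphism with local sections along whose fibres the group acts locally transitively is a
geometric quotient. Local sections give surjectivity, the quotient topology and injectivity on
functions; local transitivity gives the image of `(σ, p₂)` and, together with the sections, the
descent of invariant functions. -/
theorem isGeometricQuotient_of_hasLocalSections (hinv : actionMap G X ≫ φ = snd G X ≫ φ)
    (hs : HasLocalSections φ) (ht : IsLocallyTransitive G φ) : IsGeometricQuotient G φ where
  invariant := hinv
  surjective y := by
    obtain ⟨V, hy, s, hs⟩ := hs y
    obtain ⟨v, rfl⟩ := exists_ι_eq hy
    exact ⟨s v, by rw [← Scheme.Hom.comp_apply, hs]⟩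
  range_eq := by
    apply Set.Subset.antisymm
    · rintro _ ⟨z, rfl⟩
      refine ⟨pullback.lift (actionMap G X) (snd G X) hinv z, ?_⟩
      rw [← Scheme.Hom.comp_apply, comp_lift, pullback.lift_fst, pullback.lift_snd]
    · rintro _ ⟨z, rfl⟩
      obtain ⟨W, hz, g, hg⟩ := ht (pullback φ φ) (pullback.fst φ φ) (pullback.snd φ φ)
        pullback.condition z
      obtain ⟨w, rfl⟩ := exists_ι_eq hz
      refine ⟨lift g (W.ι ≫ pullback.snd φ φ) w, ?_⟩
      rw [← Scheme.Hom.comp_apply, comp_lift, hg, lift_snd, ← comp_lift, Scheme.Hom.comp_apply]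
  submersive U := by
    refine ⟨fun hU => hU.preimage φ.continuous, fun hU => ?_⟩
    refine isOpen_iff_mem_nhds.2 fun y hy => ?_
    obtain ⟨V, hyV, s, hs⟩ := hs y
    have e : V.ι ⁻¹' U = s ⁻¹' (φ ⁻¹' U) := Set.ext fun v => by
      rw [Set.mem_preimage, Set.mem_preimage, Set.mem_preimage, ← Scheme.Hom.comp_apply, hs]
    have h := V.ι.isOpenEmbedding.isOpenMap _ (e ▸ hU.preimage s.continuous)
    obtain ⟨v, rfl⟩ := exists_ι_eq hyV
    exact Filter.mem_of_superset (h.mem_nhds ⟨v, hy, rfl⟩) (Set.image_preimage_subset _ _)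
  injective U f f' h := by
    refine section_ext_of_ι_appLE fun y hy => ?_
    obtain ⟨V, hyV, s, hs⟩ := hs y
    have hW : V ⊓ U ≤ U := inf_le_right
    refine ⟨V ⊓ U, hW, ⟨hyV, hy⟩, ?_⟩
    have e : (Y.homOfLE (inf_le_left : V ⊓ U ≤ V) ≫ s) ≫ φ = (V ⊓ U).ι := by
      rw [Category.assoc, hs, Scheme.homOfLE_ι]
    have hle : ⊤ ≤ (Y.homOfLE (inf_le_left : V ⊓ U ≤ V) ≫ s) ⁻¹ᵁ φ ⁻¹ᵁ U := by
      rw [← Scheme.Hom.comp_preimage, e]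
      exact top_le_ι_preimage hW
    have := congrArg ((Y.homOfLE (inf_le_left : V ⊓ U ≤ V) ≫ s).appLE (φ ⁻¹ᵁ U) ⊤ hle).hom h
    rw [Scheme.Hom.app_eq_appLE, appLE_appLE, appLE_appLE] at this
    rwa [appLE_eq_of_eq e _ (top_le_ι_preimage hW)] at this
  mem_range_iff U f := by
    constructor
    · rintro ⟨h, rfl⟩
      rw [Scheme.Hom.app_eq_appLE]
      refine (appLE_appLE _ _ _ _ h).trans (Eq.trans ?_ (appLE_appLE _ _ _ _ h).symm)
      rw [appLE_eq_of_eq hinv]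
    · intro hf
      -- the values of `f` on local sections of `φ` do not depend on the sections, so they glue
      have hs' : ∀ y : U, ∃ (V : Y.Opens) (_ : y.1 ∈ V) (_ : V ≤ U) (s : V.toScheme ⟶ X),
          s ≫ φ = V.ι := fun y => by
        obtain ⟨V, hyV, s, hs⟩ := hs y
        exact ⟨V ⊓ U, ⟨hyV, y.2⟩, inf_le_right, Y.homOfLE inf_le_left ≫ s, by
          rw [Category.assoc, hs, Scheme.homOfLE_ι]⟩
      choose V hyV hVU s hs using hs'
      have hle : ∀ y, ⊤ ≤ s y ⁻¹ᵁ φ ⁻¹ᵁ U := fun y => by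
        rw [← Scheme.Hom.comp_preimage, hs]
        exact top_le_ι_preimage (hVU y)
      obtain ⟨h, hh⟩ := exists_section_of_ι_appLE V hVU
        (fun y hy => TopologicalSpace.Opens.mem_iSup.2 ⟨⟨y, hy⟩, hyV _⟩)
        (fun y => ((s y).appLE (φ ⁻¹ᵁ U) ⊤ (hle y)).hom f) (fun y z => by
          rw [appTop_appLE, appTop_appLE]
          refine ht.appLE_eq le_rfl hf _ _ ?_ _ _
          rw [Category.assoc, Category.assoc, hs, hs, Scheme.homOfLE_ι, Scheme.homOfLE_ι])
      refine ⟨h, section_ext_of_ι_appLE fun x hx => ?_⟩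
      have hVx : φ ⁻¹ᵁ V ⟨φ x, hx⟩ ≤ φ ⁻¹ᵁ U := fun x hx => hVU _ hx
      refine ⟨φ ⁻¹ᵁ V ⟨φ x, hx⟩, hVx, hyV _, ?_⟩
      have hr : (φ ∣_ V ⟨φ x, hx⟩) ≫ (V ⟨φ x, hx⟩).ι = (φ ⁻¹ᵁ V ⟨φ x, hx⟩).ι ≫ φ :=
        morphismRestrict_ι φ _
      have hle' : ⊤ ≤ ((φ ∣_ V ⟨φ x, hx⟩) ≫ (V ⟨φ x, hx⟩).ι) ⁻¹ᵁ U := by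
        rw [hr]
        exact top_le_ι_preimage hVx
      rw [Scheme.Hom.app_eq_appLE, appLE_appLE, ← appLE_eq_of_eq hr hle',
        ← appTop_appLE _ _ (top_le_ι_preimage (hVU _)), hh, appTop_appLE]
      refine ht.appLE_eq le_rfl hf _ _ ?_ _ _
      rw [Category.assoc, hs, hr]

theorem HasLocalSections.baseChange (hs : HasLocalSections φ) {Y' : Scheme.{u}} (b : Y' ⟶ Y) :
    HasLocalSections (pullback.snd φ b) := fun y => by
  obtain ⟨V, hy, s, hs⟩ := hs (b y)
  refine ⟨b ⁻¹ᵁ V, hy, pullback.lift ((b ∣_ V) ≫ s) (b ⁻¹ᵁ V).ι ?_, pullback.lift_snd _ _ _⟩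
  rw [Category.assoc, hs, morphismRestrict_ι]

theorem IsLocallyTransitive.baseChange (ht : IsLocallyTransitive G φ)
    (hinv : actionMap G X ≫ φ = snd G X ≫ φ) {Y' : Scheme.{u}} (b : Y' ⟶ Y) :
    letI : ModObj G (pullback φ b) := baseChangeAction hinv b
    IsLocallyTransitive G (pullback.snd φ b) := by
  intro T x₁ x₂ hx t
  obtain ⟨W, hW, g, hg⟩ := ht T (x₁ ≫ pullback.fst φ b) (x₂ ≫ pullback.fst φ b) (by
    rw [Category.assoc, Category.assoc, pullback.condition, reassoc_of% hx]) t
  refine ⟨W, hW, g, ?_⟩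
  change _ ≫ pullback.lift _ _ _ = _
  apply pullback.hom_ext
  · rw [Category.assoc, pullback.lift_fst, lift_whiskerLeft_assoc, Category.assoc, hg,
      Category.assoc]
  · rw [Category.assoc, pullback.lift_snd, lift_snd_assoc, Category.assoc, Category.assoc, hx]

/-- The criterion: local sections and local transitivity are stable under base change, so they
give a universal geometric quotient. -/
theorem isUniversalGeometricQuotient_of_hasLocalSections
    (hinv : actionMap G X ≫ φ = snd G X ≫ φ) (hs : HasLocalSections φ)
    (ht : IsLocallyTransitive G φ) : IsUniversalGeometricQuotient G φ := by
  refine ⟨hinv, fun Y' b => ?_⟩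
  let : ModObj G (pullback φ b) := baseChangeAction hinv b
  refine isGeometricQuotient_of_hasLocalSections ?_ (hs.baseChange b) (ht.baseChange hinv b)
  change pullback.lift _ _ _ ≫ _ = _
  rw [pullback.lift_snd]

end Criterion

section Points

variable {Γ : Type u} [Monoid Γ] {T : Scheme.{u}}

/-! ### Points of the character variety -/

variable (Γ) in
/-- The generator `tr σ_Γ(γ)` of the ring of traces and determinants. -/
noncomputable def chTrace (γ : Γ) : A₂Ch Γ :=
  ⟨(univRepRk Γ γ).trace, Subring.subset_closure (Or.inl ⟨γ, rfl⟩)⟩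

variable (Γ) in
/-- The generator `det σ_Γ(γ)` of the ring of traces and determinants. -/
noncomputable def chDet (γ : Γ) : A₂Ch Γ :=
  ⟨(univRepRk Γ γ).det, Subring.subset_closure (Or.inr ⟨γ, rfl⟩)⟩

theorem chDisc_eq (γ : Γ) : chDisc Γ γ = chTrace Γ γ ^ 2 - 4 * chDet Γ γ := rfl

theorem A₂Ch_hom_ext {R : Type*} [CommRing R] {f g : A₂Ch Γ →+* R}
    (ht : ∀ γ, f (chTrace Γ γ) = g (chTrace Γ γ)) (hd : ∀ γ, f (chDet Γ γ) = g (chDet Γ γ)) :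
    f = g := by
  refine RingHom.ext fun ⟨a, ha⟩ => ?_
  unfold A₂Ch at ha
  induction ha using Subring.closure_induction with
  | mem x hx =>
    rcases hx with ⟨γ, rfl⟩ | ⟨γ, rfl⟩
    · exact ht γ
    · exact hd γ
  | zero => exact (map_zero f).trans (map_zero g).symm
  | one => exact (map_one f).trans (map_one g).symm
  | add x y hx hy h h' =>
    exact (map_add f ⟨x, hx⟩ ⟨y, hy⟩).trans
      ((congrArg₂ (· + ·) h h').trans (map_add g ⟨x, hx⟩ ⟨y, hy⟩).symm)
  | neg x hx h =>
    exact (map_neg f ⟨x, hx⟩).trans ((congrArg Neg.neg h).trans (map_neg g ⟨x, hx⟩).symm)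
  | mul x y hx hy h h' =>
    exact (map_mul f ⟨x, hx⟩ ⟨y, hy⟩).trans
      ((congrArg₂ (· * ·) h h').trans (map_mul g ⟨x, hx⟩ ⟨y, hy⟩).symm)

/-- The ring homomorphism attached to a `T`-valued point of `Ch₂(Γ)_{s.s.}`. -/
noncomputable def chPoint (y : T ⟶ ChSS Γ) : A₂Ch Γ →+* Γ(T, ⊤) :=
  specPoints T (A₂Ch Γ) (y ≫ (chSSOpen Γ).ι)

theorem chPoint_comp {T' : Scheme.{u}} (f : T' ⟶ T) (y : T ⟶ ChSS Γ) :
    chPoint (f ≫ y) = f.appTop.hom.comp (chPoint y) := by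
  rw [chPoint, Category.assoc, specPoints_comp]
  rfl

theorem chPoint_ext {y y' : T ⟶ ChSS Γ}
    (ht : ∀ γ, chPoint y (chTrace Γ γ) = chPoint y' (chTrace Γ γ))
    (hd : ∀ γ, chPoint y (chDet Γ γ) = chPoint y' (chDet Γ γ)) : y = y' := by
  rw [← cancel_mono (chSSOpen Γ).ι]
  exact (specPoints T (A₂Ch Γ)).injective (A₂Ch_hom_ext ht hd)

theorem chPoint_comp_piSS (x : T ⟶ RepSS Γ) (a : A₂Ch Γ) :
    chPoint (x ≫ piSS Γ) a = specPoints T (A₂rk Γ) (x ≫ (repSSOpen Γ).ι) a.1 := by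
  have h : (x ≫ piSS Γ) ≫ (chSSOpen Γ).ι = (x ≫ (repSSOpen Γ).ι) ≫ piRk Γ := by
    rw [Category.assoc, Category.assoc, piSS, Scheme.Hom.resLE_comp_ι]
  rw [chPoint, h]
  generalize x ≫ (repSSOpen Γ).ι = z
  obtain ⟨φ, rfl⟩ := (specPoints T (A₂rk Γ)).symm.surjective z
  have e : (specPoints T (A₂rk Γ)).symm φ ≫ piRk Γ =
      (specPoints T (A₂Ch Γ)).symm (φ.comp (A₂Ch Γ).subtype) := by
    change (T.toSpecΓ ≫ Spec.map (CommRingCat.ofHom φ)) ≫ piRk Γ = T.toSpecΓ ≫ Spec.map _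
    rw [Category.assoc, piRk, ← Spec.map_comp]
    rfl
  rw [e, Equiv.apply_symm_apply, Equiv.apply_symm_apply]
  rfl

theorem trace_repOf (x : T ⟶ RepSS Γ) (γ : Γ) :
    ((repOf x).1 γ).trace = chPoint (x ≫ piSS Γ) (chTrace Γ γ) := by
  rw [chPoint_comp_piSS]
  exact (AddMonoidHom.map_trace (specPoints T (A₂rk Γ) (x ≫ (repSSOpen Γ).ι)).toAddMonoidHom
    (univRepRk Γ γ)).symm

theorem det_repOf (x : T ⟶ RepSS Γ) (γ : Γ) :
    ((repOf x).1 γ).det = chPoint (x ≫ piSS Γ) (chDet Γ γ) := by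
  rw [chPoint_comp_piSS]
  exact (RingHom.map_det (specPoints T (A₂rk Γ) (x ≫ (repSSOpen Γ).ι)) (univRepRk Γ γ)).symm

theorem comp_piSS_eq_iff {x₁ x₂ : T ⟶ RepSS Γ} :
    x₁ ≫ piSS Γ = x₂ ≫ piSS Γ ↔
      (∀ γ, ((repOf x₁).1 γ).trace = ((repOf x₂).1 γ).trace) ∧
        ∀ γ, ((repOf x₁).1 γ).det = ((repOf x₂).1 γ).det := by
  refine ⟨fun h => ⟨fun γ => ?_, fun γ => ?_⟩, fun h => chPoint_ext (fun γ => ?_) fun γ => ?_⟩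
  · rw [trace_repOf, trace_repOf, h]
  · rw [det_repOf, det_repOf, h]
  · rw [← trace_repOf, ← trace_repOf, h.1]
  · rw [← det_repOf, ← det_repOf, h.2]

theorem actionMap_comp_piSS (Γ : Type u) [Monoid Γ] :
    actionMap PGL₂.{u} (RepSS Γ) ≫ piSS Γ = snd PGL₂.{u} (RepSS Γ) ≫ piSS Γ := by
  have h := repOf_lift_actMor (𝟙 (PGL₂.{u} ⊗ RepSS Γ))
  rw [Category.id_comp, Category.id_comp, Category.id_comp] at h
  change actMor Γ ≫ piSS Γ = _
  rw [comp_piSS_eq_iff, h]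
  exact ⟨fun γ => trace_aut (autOf (fst _ _)) ((repOf (snd _ _)).1 γ),
    fun γ => det_aut (autOf (fst _ _)) ((repOf (snd _ _)).1 γ)⟩

/-! ### Local transitivity and local sections -/

theorem isUnit_ι_appTop_basicOpen (a : Γ(T, ⊤)) : IsUnit ((T.basicOpen a).ι.appTop.hom a) := by
  have h := (T.toLocallyRingedSpace.toRingedSpace.isUnit_res_basicOpen a).map
    (T.presheaf.map (homOfLE ((T.basicOpen a).ι_image_le ⊤)).op).hom
  have e := T.presheaf.map_comp (homOfLE (le_top : T.basicOpen a ≤ ⊤)).op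
    (homOfLE ((T.basicOpen a).ι_image_le ⊤)).op
  have e' := congrArg (fun f => f.hom a) e
  exact e' ▸ h

/-- Two representations with semi-simple mold and the same traces and determinants are conjugate
near each point `t`: there is a `γ` with `m(ρ γ)` nonzero at `t`, so `ρ₁ γ` and `ρ₂ γ` both have
cyclic vectors over the residue field, and these can be lifted to a neighbourhood. -/
theorem isLocallyTransitive_piSS (Γ : Type u) [Monoid Γ] :
    IsLocallyTransitive PGL₂.{u} (piSS Γ) := by
  intro T x₁ x₂ hx t
  obtain ⟨ht, hd⟩ := comp_piSS_eq_iff.1 hx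
  set ρ₁ := (repOf x₁).1 with hρ₁
  set ρ₂ := (repOf x₂).1 with hρ₂
  obtain ⟨γ, hγ⟩ := ((hasSemisimpleMold_iff _).1 (repOf x₁).2).2 t
  have hdisc : disc (ρ₁ γ) = disc (ρ₂ γ) := by rw [disc, disc, ht, hd]
  let ev := (T.evaluation ⊤ t trivial).hom
  have hev : ∀ a : Γ(T, ⊤), ev a ≠ 0 ↔ t ∈ T.basicOpen a := fun a =>
    T.evaluation_ne_zero_iff_mem_basicOpen t (U := ⊤) trivial a
  have hγ₁ := (hev _).2 hγ
  have hγ₂ := hγ₁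
  rw [← hρ₁, hdisc] at hγ₂
  obtain ⟨x, y, hxy⟩ := exists_det_cyclicMatrix_ne_zero ev _ hγ₁
  obtain ⟨z, w, hzw⟩ := exists_det_cyclicMatrix_ne_zero ev _ hγ₂
  -- over `W` the discriminant is invertible and both representations have cyclic vectors
  let a := disc (ρ₁ γ) * ((cyclicMatrix (ρ₁ γ) x y).det * (cyclicMatrix (ρ₂ γ) z w).det)
  let W := T.basicOpen a
  have htW : t ∈ W := (hev a).1 (by
    rw [map_mul, map_mul]
    exact mul_ne_zero hγ₁ (mul_ne_zero hxy hzw))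
  let r := W.ι.appTop.hom
  have hu : IsUnit (r a) := isUnit_ι_appTop_basicOpen a
  rw [map_mul, map_mul, IsUnit.mul_iff, IsUnit.mul_iff] at hu
  have e₁ : (repOf (W.ι ≫ x₁)).1 = mapRep r ρ₁ := repOf_comp _ _
  have e₂ : (repOf (W.ι ≫ x₂)).1 = mapRep r ρ₂ := repOf_comp _ _
  have rk₁ := ((hasSemisimpleMold_iff _).1 (repOf (W.ι ≫ x₁)).2).1
  have rk₂ := ((hasSemisimpleMold_iff _).1 (repOf (W.ι ≫ x₂)).2).1
  have hx' : (W.ι ≫ x₁) ≫ piSS Γ = (W.ι ≫ x₂) ≫ piSS Γ := by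
    rw [Category.assoc, hx, Category.assoc]
  obtain ⟨ht', hd'⟩ := comp_piSS_eq_iff.1 hx'
  obtain ⟨φ, hφ⟩ := rk₁.exists_actRep_eq rk₂ ht' hd' γ
    (by rw [e₁, mapRep_apply, disc_map]; exact hu.1)
    (x := r x) (y := r y) (z := r z) (w := r w)
    (by rw [e₁, mapRep_apply, det_cyclicMatrix_map]; exact hu.2.1)
    (by rw [e₂, mapRep_apply, det_cyclicMatrix_map]; exact hu.2.2)
  refine ⟨W, htW, PGL₂RepresentableBy.homEquiv.symm φ, repOf_injective ?_⟩
  have h := repOf_lift_actMor (lift (PGL₂RepresentableBy.homEquiv.symm φ) (W.ι ≫ x₂))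
  rw [lift_fst, lift_snd] at h
  refine h.trans ?_
  have hφ' : autOf (PGL₂RepresentableBy.homEquiv.symm φ) = φ :=
    PGL₂RepresentableBy.homEquiv.apply_symm_apply φ
  rw [hφ']
  exact hφ

/-- Over the open set where `m(σ_Γ(γ))` is invertible, the section of `π_{Γ,s.s.}` is given by the
representation descended from the universal one to the localized ring of traces and determinants. -/
theorem hasLocalSections_piSS (Γ : Type u) [Monoid Γ] : HasLocalSections (piSS Γ) := by
  intro y
  obtain ⟨γ, hγ⟩ := TopologicalSpace.Opens.mem_iSup.1 y.2
  let ψ := chPoint (𝟙 (ChSS Γ))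
  let V := (ChSS Γ).basicOpen (ψ (chDisc Γ γ))
  have hy : y ∈ V := by
    have h := specPoints_preimage_basicOpen (A := A₂Ch Γ) (𝟙 (ChSS Γ) ≫ (chSSOpen Γ).ι)
      (chDisc Γ γ)
    exact h.le hγ
  have hψ : chPoint V.ι = V.ι.appTop.hom.comp ψ := by
    rw [← chPoint_comp, Category.comp_id]
  have hu : IsUnit (chPoint V.ι (chDisc Γ γ)) := by
    rw [hψ]
    exact isUnit_ι_appTop_basicOpen _
  obtain ⟨ρ, hrk, ht, hd⟩ := rankLETwo_univRepRk.exists_rep_localizationAway (A₂Ch Γ).subtype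
    Subtype.val_injective (t := chTrace Γ) (d := chDet Γ) (fun _ => rfl) (fun _ => rfl)
    (chDisc_eq γ)
  let l : Localization.Away (chDisc Γ γ) →+* Γ(V.toScheme, ⊤) := IsLocalization.Away.lift _ hu
  have hl : ∀ a, l (algebraMap _ _ a) = chPoint V.ι a := IsLocalization.Away.lift_eq _ hu
  have ht' : ∀ α, (mapRep l ρ α).trace = chPoint V.ι (chTrace Γ α) := fun α => by
    rw [← hl, ← ht]
    exact (AddMonoidHom.map_trace l.toAddMonoidHom (ρ α)).symm
  have hd' : ∀ α, (mapRep l ρ α).det = chPoint V.ι (chDet Γ α) := fun α => by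
    rw [← hl, ← hd]
    exact (RingHom.map_det l (ρ α)).symm
  have hss : HasSemisimpleMold (mapRep l ρ) := by
    refine (hasSemisimpleMold_iff _).2 ⟨fun α β δ r => ?_, fun v => ⟨γ, ?_⟩⟩
    · rw [tripleMinor_mapRep, hrk, map_zero]
    · have e : disc (mapRep l ρ γ) = chPoint V.ι (chDisc Γ γ) := by
        rw [disc, ht', hd', chDisc_eq, map_sub, map_mul, map_pow, map_ofNat]
      rw [e, Scheme.basicOpen_of_isUnit _ hu]
      trivial
  let s : V.toScheme ⟶ RepSS Γ := (repSSRepresentableBy Γ).homEquiv.symm ⟨_, hss⟩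
  have hs : (repOf s).1 = mapRep l ρ :=
    congrArg Subtype.val ((repSSRepresentableBy Γ).homEquiv.apply_symm_apply ⟨_, hss⟩)
  refine ⟨V, hy, s, chPoint_ext (fun α => ?_) fun α => ?_⟩
  · rw [← trace_repOf, hs, ht']
  · rw [← det_repOf, hs, hd']

end Points

end TwoDimRep

theorem mainTheorem5 (Γ : Type u) [Monoid Γ] :
    TwoDimRep.IsUniversalGeometricQuotient TwoDimRep.PGL₂.{u} (TwoDimRep.piSS Γ) :=
  TwoDimRep.isUniversalGeometricQuotient_of_hasLocalSections (TwoDimRep.actionMap_comp_piSS Γ)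
    (TwoDimRep.hasLocalSections_piSS Γ) (TwoDimRep.isLocallyTransitive_piSS Γ)
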